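/- \textbf{Lemma (Lower bound on field energy), with its application to the magnetic field.} Setting. Let $\mathcal F$ be the bosonic Fock space of photons with modes $(k,\lambda)\in\mathbb R^3\times\{1,2\}$, with annihilation and creation operators $a_\lambda(k),a^*_\lambda(k)$, $[a_\lambda(k),a^*_{\lambda'}(k')]=\delta_{\lambda\lambda'}\delta(k-k')$, and let $H_f=\sum_{\lambda=1}^2\int_{\mathbb R^3}|k|\,a^*_\lambda(k)a_\lambda(k)\,dk$ be the field energy. Let $0<\Lambda<\infty$ and let $J$ be a set of integers. For $\lambda=1,2$ and $j\in J$ let $v_{\lambda,j}$ be a tempered distribution on $\mathbb R^3$ (for instance a function) whose Fourier transform, with the convention $\widehat g(k)=(2\pi)^{-3/2}\int g(x)e^{-ik\cdot x}\,dx$, is a function $\widehat v_{\lambda,j}$ with $\int_{|k|<\Lambda}|k|\,|\widehat v_{\lambda,j}(k)|^2dk<\infty$. Put $$L_j(y)=\sum_{\lambda=1}^2\int_{|k|<\Lambda}\sqrt{|k|}\;\widehat v_{\lambda,j}(k)\,e^{ik\cdot y}a_\lambda(k)\,dk .$$ For a real function $w\in L^1(\mathbb R^3)$ let $$\|w\|_v=\sup_{f}\frac{\sum_j\int_{\mathbb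 R^3}\big|\sum_\lambda (f_\lambda * v_{\lambda,j})(x)\big|^2|w(x)|\,dx}{\sum_\lambda\int_{\mathbb R^3}|f_\lambda(x)|^2dx},$$ the supremum being over nonzero pairs $f=(f_1,f_2)$ of Schwartz functions. All operator inequalities below are inequalities of quadratic forms; in particular $L^*L$ has the form $\|L\Psi\|^2$ and $\pm(L\pm L^*)^2$ has the form $\|(L\pm L^*)\Psi\|^2$. (a) If $\|w\|_v\le1$, then on all $\Psi\in\mathcal F$ of finite field energy $$H_f\ \ge\ \sum_j\int_{\mathbb R^3}w(y)\,L_j^*(y)L_j(y)\,dy ,$$ where the integrals and the sum over $j$ converge absolutely. (b) If $\|w\|_v\le 1$ and moreover $w(y)\ge0$ for all $y$, then, for any choice of the sign $+$ or $-$ for each $j$, $$H_f\ \ge\ \frac14\sum_j\pm\int_{\mathbb R^3}w(y)\,\big(L_j(y)\pm L_j^*(y)\big)^2dy-\frac12\sum_j\sum_{\lambda=1}^2\int_{|k|<\Lambda}|k|\,|\widehat v_{\lambda,j}(k)|^2dk\int_{\mathbb R^3}w(y)\,dy .$$ (c) Let $\varepsilon_1(k),\varepsilon_2(k)\in\mathbb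 R^3$ be measurable in $k$ and, for $k\ne0$, orthonormal and perpendicular to $k$, and let $$B^\Lambda(x)=\frac{i}{2\pi}\sum_{\lambda=1}^2\int_{|k|\le\Lambda}\frac{k\wedge\varepsilon_\lambda(k)}{\sqrt{|k|}}\Big(a_\lambda(k)e^{ik\cdot x}-a^*_\lambda(k)e^{-ik\cdot x}\Big)dk .$$ If $w\in L^1(\mathbb R^3)$ and $0\le w(y)\le1$ for all $y$, then $$H_f\ \ge\ \frac1{8\pi}\int_{\mathbb R^3}B^\Lambda(x)^2\,w(x)\,dx-\frac{\Lambda^4}{8\pi^2}\int_{\mathbb R^3}w(y)\,dy .$$ -/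

import Mathlib

open MeasureTheory SchwartzMap FourierTransform
open scoped ENNReal ComplexConjugate SchwartzMap

noncomputable section

namespace FieldEnergy

/-- Position space and momentum space `ℝ³`. -/
abbrev R3 : Type := EuclideanSpace ℝ (Fin 3)

/-! ### Fourier transform and convolution for tempered distributions

The convention is `ĝ(k) = (2π)^(-3/2) ∫ g(x) exp(-i k·x) dx`. -/

/-- Dilation `x ↦ x / (2π)` of `ℝ³`. -/
def dilation : R3 ≃L[ℝ] R3 :=
  ContinuousLinearEquiv.smulLeft (Units.mk0 ((2 * Real.pi)⁻¹ : ℝ) (by positivity))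

/-- The Fourier transform of a Schwartz function; see `schwartzFourier_apply`. -/
def schwartzFourier (φ : 𝓢(R3, ℂ)) : 𝓢(R3, ℂ) :=
  (((2 * Real.pi) ^ (-(3 / 2) : ℝ) : ℝ) : ℂ) •
    compCLMOfContinuousLinearEquiv ℂ dilation (𝓕 φ)

theorem schwartzFourier_apply (φ : 𝓢(R3, ℂ)) (x : R3) :
    schwartzFourier φ x = (((2 * Real.pi) ^ (-(3 / 2) : ℝ) : ℝ) : ℂ) *
      ∫ k : R3, φ k * Complex.exp (-(Complex.I * (inner ℝ k x : ℝ))) := by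
  have hd : dilation x = ((2 * Real.pi)⁻¹ : ℝ) • x := rfl
  have h : schwartzFourier φ x = (((2 * Real.pi) ^ (-(3 / 2) : ℝ) : ℝ) : ℂ) *
      (𝓕 φ) (dilation x) := rfl
  rw [h, SchwartzMap.fourier_coe, Real.fourier_eq']
  congr 1
  refine integral_congr_ae (Filter.Eventually.of_forall fun k => ?_)
  simp only [hd, inner_smul_right, smul_eq_mul]
  rw [mul_comm]
  congr 2
  have : (Real.pi : ℂ) ≠ 0 := by exact_mod_cast Real.pi_ne_zero
  push_cast
  field_simp

/-- The function `vhat` is the Fourier transform of the tempered distribution `v`: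
`⟨vhat, φ⟩ = ⟨v, φ̂⟩` for all Schwartz functions `φ`. -/
def IsFourierTransformOf (vhat : R3 → ℂ) (v : 𝓢'(R3, ℂ)) : Prop :=
  ∀ φ : 𝓢(R3, ℂ), Integrable (fun k => vhat k * φ k) ∧
    v (schwartzFourier φ) = ∫ k, vhat k * φ k

/-- The Schwartz function `y ↦ f (x - y)`. -/
def reflectTranslate (f : 𝓢(R3, ℂ)) (x : R3) : 𝓢(R3, ℂ) :=
  compSubConstCLM ℂ x
    (compCLMOfContinuousLinearEquiv ℂ (ContinuousLinearEquiv.neg ℝ (M := R3)) f)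

theorem reflectTranslate_apply (f : 𝓢(R3, ℂ)) (x y : R3) :
    reflectTranslate f x y = f (x - y) := by
  change f (-(y - x)) = f (x - y)
  rw [neg_sub]

/-- The convolution `(f ∗ v)(x) = ∫ f(x - y) v(y) dy`, the integral being the pairing with the
tempered distribution `v`. -/
def conv (f : 𝓢(R3, ℂ)) (v : 𝓢'(R3, ℂ)) (x : R3) : ℂ :=
  v (reflectTranslate f x)

/-- The norm
`‖w‖_v = sup_f (∑_j ∫ |∑_λ (f_λ ∗ v_{λ,j})(x)|² |w(x)| dx) / (∑_λ ∫ |f_λ(x)|² dx)`.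
(For `f = 0` the quotient is `0 / 0 = 0` and does not affect the supremum.) -/
def weightNorm {J : Set ℤ} (v : Fin 2 → J → 𝓢'(R3, ℂ)) (w : R3 → ℝ) : ℝ≥0∞ :=
  ⨆ f : Fin 2 → 𝓢(R3, ℂ),
    (∑' j : J, ∫⁻ x, ‖∑ l, conv (f l) (v l j) x‖ₑ ^ 2 * ‖w x‖ₑ) /
      (∑ l, ∫⁻ x, ‖f l x‖ₑ ^ 2)

/-! ### The photon Fock space -/

/-- A photon mode `(k, λ)`: momentum and polarization index. -/
abbrev Mode : Type := R3 × Fin 2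

/-- `∫ dk ∑_λ` -/
def modeMeasure : Measure Mode := (volume : Measure R3).prod Measure.count

/-- The measure on `n`-photon configurations. -/
def photonMeasure (n : ℕ) : Measure (Fin n → Mode) := Measure.pi fun _ => modeMeasure

/-- A sequence of `n`-photon amplitudes, `n = 0, 1, 2, …`. -/
abbrev FockSeq : Type := ∀ n : ℕ, (Fin n → Mode) → ℂ

/-- `‖Ψ‖² = ∑_n ∫ |Ψ_n|²`, with value `∞` if the sequence is not in Fock space. -/
def normSq (Ψ : FockSeq) : ℝ≥0∞ := ∑' n, ∫⁻ x, ‖Ψ n x‖ₑ ^ 2 ∂photonMeasure n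

/-- `Ψ` is (a representative of) a vector in the bosonic Fock space: each `Ψ_n` is measurable and
symmetric in the pairs `(k_i, λ_i)`, up to null sets, and `∑_n ∫ |Ψ_n|² < ∞`. -/
structure IsFockVector (Ψ : FockSeq) : Prop where
  measurable : ∀ n, AEStronglyMeasurable (Ψ n) (photonMeasure n)
  symmetric : ∀ (n : ℕ) (σ : Equiv.Perm (Fin n)),
    (fun x => Ψ n (fun i => x (σ i))) =ᵐ[photonMeasure n] Ψ n
  normSq_lt_top : normSq Ψ < ∞

/-- The annihilation operator `∑_λ ∫ g_λ(k) a_λ(k) dk`, where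
`(a_λ(k) Ψ)_n = √(n+1) Ψ_{n+1}(⋯, (k, λ))`. -/
def annihilate (g : Fin 2 → R3 → ℂ) (Ψ : FockSeq) : FockSeq := fun n x =>
  (Real.sqrt (n + 1) : ℂ) *
    ∑ l, ∫ k : R3, g l k * Ψ (n + 1) (Fin.snoc (α := fun _ => Mode) x (k, l))

/-- The creation operator `∑_λ ∫ g_λ(k) a*_λ(k) dk`, the formal adjoint of `annihilate (conj g)`. -/
def create (g : Fin 2 → R3 → ℂ) (Ψ : FockSeq) : FockSeq
  | 0, _ => 0
  | n + 1, x => ((Real.sqrt (n + 1))⁻¹ : ℂ) *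
      ∑ i : Fin (n + 1), g (x i).2 (x i).1 * Ψ n (fun m => x (i.succAbove m))

/-- The quadratic form `(Ψ, H_f Ψ) ∈ [0, ∞]` of the field energy `H_f = ∑_λ ∫ |k| a*_λ(k) a_λ(k) dk`,
which multiplies the `n`-photon amplitude by `|k_1| + ⋯ + |k_n|`. -/
def fieldEnergy (Ψ : FockSeq) : ℝ≥0∞ :=
  ∑' n, ∫⁻ x, ENNReal.ofReal (∑ i, ‖(x i).1‖) * ‖Ψ n x‖ₑ ^ 2 ∂photonMeasure n

/-! ### The field modes -/

/-- The smearing function `1_{|k| < Λ} √|k| vhat_λ(k) exp(i k·y)`. -/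
def modeFunction (Λ : ℝ) (vhat : Fin 2 → R3 → ℂ) (y : R3) (l : Fin 2) (k : R3) : ℂ :=
  (Metric.ball (0 : R3) Λ).indicator
    (fun k => (Real.sqrt ‖k‖ : ℂ) * vhat l k * Complex.exp (Complex.I * (inner ℝ k y : ℝ))) k

/-- `L(y) = ∑_λ ∫_{|k| < Λ} √|k| vhat_λ(k) exp(i k·y) a_λ(k) dk`. -/
def fieldL (Λ : ℝ) (vhat : Fin 2 → R3 → ℂ) (y : R3) (Ψ : FockSeq) : FockSeq :=
  annihilate (modeFunction Λ vhat y) Ψ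

/-- The adjoint `L*(y)`. -/
def fieldLstar (Λ : ℝ) (vhat : Fin 2 → R3 → ℂ) (y : R3) (Ψ : FockSeq) : FockSeq :=
  create (fun l k => conj (modeFunction Λ vhat y l k)) Ψ

/-- `ε_1, ε_2` are real measurable polarization vectors: for `k ≠ 0`, the vectors `ε_1(k)`,
`ε_2(k)` are orthonormal and perpendicular to `k`. -/
structure IsPolarization (ε : Fin 2 → R3 → R3) : Prop where
  measurable : ∀ l, Measurable (ε l)
  orthonormal : ∀ k, k ≠ 0 → Orthonormal ℝ (fun l => ε l k)
  perp : ∀ l k, k ≠ 0 → inner ℝ k (ε l k) = 0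

/-- The coefficient `1_{|k| ≤ Λ} (k ∧ ε_λ(k))_j / √|k| · exp(i k·x)`. -/
def magneticMode (Λ : ℝ) (ε : Fin 2 → R3 → R3) (j : Fin 3) (x : R3) (l : Fin 2) (k : R3) : ℂ :=
  (Metric.closedBall (0 : R3) Λ).indicator
    (fun k => ((crossProduct k.ofLp (ε l k).ofLp j / Real.sqrt ‖k‖ : ℝ) : ℂ) *
      Complex.exp (Complex.I * (inner ℝ k x : ℝ))) k

/-- The `j`-th component of the magnetic field with ultraviolet cutoff,
`B^Λ(x) = (i/2π) ∑_λ ∫_{|k| ≤ Λ} (k ∧ ε_λ(k))/√|k| (a_λ(k) e^{ik·x} - a*_λ(k) e^{-ik·x}) dk`. -/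
def magneticField (Λ : ℝ) (ε : Fin 2 → R3 → R3) (j : Fin 3) (x : R3) (Ψ : FockSeq) : FockSeq :=
  (Complex.I / (2 * Real.pi)) •
    (annihilate (magneticMode Λ ε j x) Ψ - create (magneticMode Λ ε j (-x)) Ψ)

end FieldEnergy

end

/-! Everything reduces to one photon. Freeze all but the last photon of `Ψ (n + 1)` and write ψ_λ(k)
for the remaining amplitude. Up to the factor √(n+1), L_j(y) produces ∑_λ ∫ A_{j,λ}(k) e^{ik·y}
ψ_λ(k) dk. For A = 1_{|k|<Λ} √|k| v̂ this is ∑_λ (f_λ ∗ v_{λ,j})(y), where f_λ has Fourier transform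
1_{|k|<Λ} √|k| ψ_λ. Hence ‖w‖_v ≤ 1 bounds its weighted square integral, summed over j, by ∑_λ ∫ |k|
|ψ_λ|². The supremum only tests Schwartz functions; density and Fatou
(`tsum_lintegral_planeWave_le`) give all square integrable ψ. Multiplying by n+1, integrating over
the frozen photons and summing over n turns the right side into the field energy, by the symmetry of
Ψ (`fieldEnergy_eq`, `tsum_lintegral_normSq_annihilate_le`). This is (a).

For (b), ‖(L ± L*)Ψ‖² ≤ 2‖LΨ‖² + 2‖L*Ψ‖², and the commutation relation (`normSq_create`) replaces
‖L*Ψ‖² by ‖LΨ‖² + ‖A‖²‖Ψ‖²; the last term is the subtracted constant.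

Part (c) feeds another one-particle bound into the same argument, with j running over the components
of B and weight (2π)⁻³ w. That bound (`magneticCoeff_bound`) is Plancherel's identity, because k ∧
ε_1 and k ∧ ε_2 are orthogonal of length |k|. -/

namespace FieldEnergy

/-! ### Square integrable functions and Cauchy–Schwarz -/

section SquareIntegrable

variable {α : Type*} [MeasurableSpace α] {ν : Measure α}

theorem memLp_two_iff_lintegral {f : α → ℂ} :
    MemLp f 2 ν ↔ AEStronglyMeasurable f ν ∧ ∫⁻ x, ‖f x‖ₑ ^ 2 ∂ν < ∞ := by
  refine and_congr_right fun _ => ?_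
  rw [eLpNorm_lt_top_iff_lintegral_rpow_enorm_lt_top (by simp) (by simp)]
  simp

theorem eLpNorm_two_sq (f : α → ℂ) : eLpNorm f 2 ν ^ 2 = ∫⁻ x, ‖f x‖ₑ ^ 2 ∂ν := by
  rw [eLpNorm_eq_lintegral_rpow_enorm_toReal (by simp) (by simp), ← ENNReal.rpow_natCast,
    ← ENNReal.rpow_mul]
  simp

theorem integral_conj_mul_self {f : α → ℂ} (hf : AEStronglyMeasurable f ν) :
    ∫ x, conj (f x) * f x ∂ν = ((∫⁻ x, ‖f x‖ₑ ^ 2 ∂ν).toReal : ℂ) := by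
  have h (x : α) : conj (f x) * f x = ((‖f x‖ ^ 2 : ℝ) : ℂ) := by
    rw [mul_comm, Complex.mul_conj, Complex.normSq_eq_norm_sq]
  simp_rw [h]
  rw [integral_complex_ofReal, integral_eq_lintegral_of_nonneg_ae
    (f := fun x => ‖f x‖ ^ 2) (Filter.Eventually.of_forall fun x => by positivity) (hf.norm.pow 2)]
  simp_rw [ENNReal.ofReal_pow (norm_nonneg _), ofReal_norm]

theorem enorm_integral_mul_sq_le {f g : α → ℂ} (hf : AEStronglyMeasurable f ν)
    (hg : AEStronglyMeasurable g ν) :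
    ‖∫ x, f x * g x ∂ν‖ₑ ^ 2 ≤ (∫⁻ x, ‖f x‖ₑ ^ 2 ∂ν) * ∫⁻ x, ‖g x‖ₑ ^ 2 ∂ν := by
  have h := ENNReal.lintegral_mul_le_Lp_mul_Lq ν Real.HolderConjugate.two_two hf.enorm hg.enorm
  calc ‖∫ x, f x * g x ∂ν‖ₑ ^ 2 ≤ (∫⁻ x, ‖f x‖ₑ * ‖g x‖ₑ ∂ν) ^ 2 := by
        gcongr
        exact (enorm_integral_le_lintegral_enorm _).trans_eq (by simp_rw [enorm_mul])
    _ ≤ _ := by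
        grw [show (∫⁻ x, ‖f x‖ₑ * ‖g x‖ₑ ∂ν) ≤ _ from h]
        rw [mul_pow, ← ENNReal.rpow_natCast, ← ENNReal.rpow_mul, ← ENNReal.rpow_natCast,
          ← ENNReal.rpow_mul]
        simp

end SquareIntegrable

/-! ### Symmetric functions of several particles and symmetrized tensor products -/

section Configurations

variable {M : Type*} [MeasurableSpace M] (μ : Measure M) [SigmaFinite μ]

theorem measurePreserving_snoc (n : ℕ) :
    MeasurePreserving (fun q : (Fin n → M) × M => (Fin.snoc (α := fun _ => M) q.1 q.2))
      ((Measure.pi fun _ : Fin n => μ).prod μ) (Measure.pi fun _ : Fin (n + 1) => μ) := by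
  have h := ((measurePreserving_piFinSuccAbove (fun _ : Fin (n + 1) => μ) (Fin.last n)).symm).comp
    (Measure.measurePreserving_swap (μ := Measure.pi fun _ : Fin n => μ) (ν := μ))
  convert h using 1
  funext q
  simp [MeasurableEquiv.piFinSuccAbove, Fin.insertNthEquiv]

theorem measurableEmbedding_perm {n : ℕ} (σ : Equiv.Perm (Fin n)) :
    MeasurableEmbedding fun (x : Fin n → M) i => x (σ i) :=
  (MeasurableEquiv.arrowCongr' σ.symm (MeasurableEquiv.refl M)).measurableEmbedding

theorem measurePreserving_perm {n : ℕ} (σ : Equiv.Perm (Fin n)) :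
    MeasurePreserving (fun (x : Fin n → M) i => x (σ i))
      (Measure.pi fun _ => μ) (Measure.pi fun _ => μ) :=
  measurePreserving_arrowCongr' (fun _ : Fin n => μ) (fun _ => μ) σ.symm (MeasurableEquiv.refl M)
    fun _ => MeasurePreserving.id μ

theorem quasiMeasurePreserving_succAbove {n : ℕ} (i : Fin (n + 1)) :
    Measure.QuasiMeasurePreserving (fun (x : Fin (n + 1) → M) m => x (i.succAbove m))
      (Measure.pi fun _ => μ) (Measure.pi fun _ => μ) :=
  Measure.quasiMeasurePreserving_snd.comp
    (measurePreserving_piFinSuccAbove (fun _ : Fin (n + 1) => μ) i).quasiMeasurePreserving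

variable {μ} in
theorem lintegral_snoc {n : ℕ} {f : (Fin (n + 1) → M) → ℝ≥0∞}
    (hf : AEMeasurable f (Measure.pi fun _ => μ)) :
    ∫⁻ x, f x ∂(Measure.pi fun _ => μ) =
      ∫⁻ x, ∫⁻ p, f (Fin.snoc (α := fun _ => M) x p) ∂μ ∂(Measure.pi fun _ : Fin n => μ) := by
  have h := measurePreserving_snoc μ n
  rw [← h.map_eq, lintegral_map' (h.map_eq ▸ hf) h.aemeasurable]
  exact lintegral_prod _ (hf.comp_quasiMeasurePreserving h.quasiMeasurePreserving)

variable {μ} in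
/-- For a symmetric function, a sum of one-particle weights may be replaced by the number of
particles times the weight of the last one. -/
theorem lintegral_sum_weight {n : ℕ} {e : M → ℝ≥0∞} (he : Measurable e)
    {f : (Fin (n + 1) → M) → ℝ≥0∞} (hf : AEMeasurable f (Measure.pi fun _ => μ))
    (hsymm : ∀ σ : Equiv.Perm (Fin (n + 1)),
      (fun x => f fun i => x (σ i)) =ᵐ[Measure.pi fun _ => μ] f) :
    ∫⁻ x, (∑ i, e (x i)) * f x ∂(Measure.pi fun _ => μ) =
      (n + 1) * ∫⁻ x, ∫⁻ p, e p * f (Fin.snoc (α := fun _ => M) x p) ∂μ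
        ∂(Measure.pi fun _ : Fin n => μ) := by
  have hm (i : Fin (n + 1)) : AEMeasurable (fun x : Fin (n + 1) → M => e (x i) * f x)
      (Measure.pi fun _ => μ) := (he.comp (measurable_pi_apply i)).aemeasurable.mul hf
  -- Transposing `i` with the last index leaves `f` unchanged almost everywhere.
  have key (i : Fin (n + 1)) : ∫⁻ x, e (x i) * f x ∂(Measure.pi fun _ => μ) =
      ∫⁻ x, e (x (Fin.last n)) * f x ∂(Measure.pi fun _ => μ) := by
    rw [← (measurePreserving_perm μ (Equiv.swap i (Fin.last n))).lintegral_comp_emb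
      (measurableEmbedding_perm _) fun x => e (x i) * f x]
    refine lintegral_congr_ae ?_
    filter_upwards [hsymm (Equiv.swap i (Fin.last n))] with x hx
    rw [hx, Equiv.swap_apply_left]
  simp_rw [Finset.sum_mul]
  rw [lintegral_finsetSum' _ fun i _ => hm i]
  simp_rw [key]
  rw [Finset.sum_const, lintegral_snoc (hm _)]
  simp

/-- The terms of the symmetrized tensor product of `G` and `ψ`. -/
def tensorTerm {n : ℕ} (G : M → ℂ) (ψ : (Fin n → M) → ℂ) (i : Fin (n + 1))
    (x : Fin (n + 1) → M) : ℂ :=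
  G (x i) * ψ fun m => x (i.succAbove m)

/-- A permutation carries the slots other than `i` to the slots other than `σ i`; τ is the
relabelling it induces, and the symmetry of ψ absorbs τ in `tensorTerm_perm`. -/
theorem exists_perm_succAbove {n : ℕ} (σ : Equiv.Perm (Fin (n + 1))) (i : Fin (n + 1)) :
    ∃ τ : Equiv.Perm (Fin n), ∀ m, σ (i.succAbove m) = (σ i).succAbove (τ m) := by
  have h (m : Fin n) : ∃ z, (σ i).succAbove z = σ (i.succAbove m) :=
    Fin.exists_succAbove_eq fun h => i.succAbove_ne m (σ.injective h)
  choose τ hτ using h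
  have hinj : Function.Injective τ := fun a b hab => by
    have := hτ a
    rw [hab, hτ b] at this
    exact (Fin.succAbove_right_injective (σ.injective this)).symm
  exact ⟨Equiv.ofBijective τ (Finite.injective_iff_bijective.1 hinj), fun m => (hτ m).symm⟩

variable {μ}

theorem tensorTerm_perm {n : ℕ} (G : M → ℂ) {ψ : (Fin n → M) → ℂ}
    (hsymm : ∀ σ : Equiv.Perm (Fin n),
      (fun x => ψ fun i => x (σ i)) =ᵐ[Measure.pi fun _ => μ] ψ)
    (σ : Equiv.Perm (Fin (n + 1))) (i : Fin (n + 1)) :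
    (fun x => tensorTerm G ψ i fun m => x (σ m)) =ᵐ[Measure.pi fun _ => μ]
      tensorTerm G ψ (σ i) := by
  obtain ⟨τ, hτ⟩ := exists_perm_succAbove σ i
  filter_upwards [(quasiMeasurePreserving_succAbove μ (σ i)).ae (hsymm τ)] with x hx
  simp only [tensorTerm, hτ]
  rw [hx]

omit [MeasurableSpace M] in
theorem tensorTerm_last_snoc {n : ℕ} (G : M → ℂ) (ψ : (Fin n → M) → ℂ) (z : Fin n → M) (q : M) :
    tensorTerm G ψ (Fin.last n) (Fin.snoc (α := fun _ => M) z q) = G q * ψ z := by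
  simp [tensorTerm]

omit [MeasurableSpace M] in
theorem tensorTerm_castSucc_snoc {n : ℕ} (G : M → ℂ) (ψ : (Fin (n + 1) → M) → ℂ)
    (z : Fin n → M) (p q : M) :
    tensorTerm G ψ (Fin.last n).castSucc
      (Fin.snoc (α := fun _ => M) (Fin.snoc (α := fun _ => M) z p : Fin (n + 1) → M) q) =
      G p * ψ (Fin.snoc (α := fun _ => M) z q) := by
  simp only [tensorTerm, Fin.snoc_castSucc, Fin.snoc_last]
  congr 2
  funext m
  refine Fin.lastCases ?_ (fun m => ?_) m
  · simp
  · have : (Fin.last n).castSucc.succAbove m.castSucc = m.castSucc.castSucc :=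
      Fin.succAbove_of_castSucc_lt _ _ (by simp [Fin.lt_def])
    rw [this]; simp

theorem lintegral_tensorTerm {n : ℕ} {G : M → ℂ} (hG : AEStronglyMeasurable G μ)
    {ψ : (Fin n → M) → ℂ} (hψ : AEStronglyMeasurable ψ (Measure.pi fun _ => μ))
    (i : Fin (n + 1)) :
    ∫⁻ x, ‖tensorTerm G ψ i x‖ₑ ^ 2 ∂(Measure.pi fun _ => μ) =
      (∫⁻ p, ‖G p‖ₑ ^ 2 ∂μ) * ∫⁻ x, ‖ψ x‖ₑ ^ 2 ∂(Measure.pi fun _ => μ) := by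
  rw [← lintegral_prod_mul (hG.enorm.pow_const 2) (hψ.enorm.pow_const 2),
    ← (measurePreserving_piFinSuccAbove (fun _ : Fin (n + 1) => μ) i).lintegral_comp_emb
      (MeasurableEquiv.measurableEmbedding _)]
  refine lintegral_congr fun x => ?_
  rw [← mul_pow, tensorTerm, enorm_mul]
  rfl

theorem memLp_tensorTerm {n : ℕ} {G : M → ℂ} (hG : MemLp G 2 μ) {ψ : (Fin n → M) → ℂ}
    (hψ : MemLp ψ 2 (Measure.pi fun _ => μ)) (i : Fin (n + 1)) :
    MemLp (tensorTerm G ψ i) 2 (Measure.pi fun _ => μ) := by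
  rw [memLp_two_iff_lintegral] at hG hψ ⊢
  refine ⟨?_, ?_⟩
  · exact (hG.1.comp_quasiMeasurePreserving (Measure.quasiMeasurePreserving_eval _ i)).mul
      (hψ.1.comp_quasiMeasurePreserving (quasiMeasurePreserving_succAbove μ i))
  · rw [lintegral_tensorTerm hG.1 hψ.1]
    exact ENNReal.mul_lt_top hG.2 hψ.2

/-- The scalar product of two different terms of a symmetrized tensor product. -/
theorem integral_conj_tensorTerm_mul {n : ℕ} {G : M → ℂ} (hG : MemLp G 2 μ)
    {ψ : (Fin (n + 1) → M) → ℂ} (hψ : MemLp ψ 2 (Measure.pi fun _ => μ))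
    (hsymm : ∀ σ : Equiv.Perm (Fin (n + 1)),
      (fun x => ψ fun i => x (σ i)) =ᵐ[Measure.pi fun _ => μ] ψ)
    {i j : Fin (n + 2)} (hij : i ≠ j) :
    ∫ x, conj (tensorTerm G ψ i x) * tensorTerm G ψ j x ∂(Measure.pi fun _ => μ) =
      ((∫⁻ z, ‖∫ p, conj (G p) * ψ (Fin.snoc (α := fun _ => M) z p) ∂μ‖ₑ ^ 2
        ∂(Measure.pi fun _ : Fin n => μ)).toReal : ℂ) := by
  -- Permutations act transitively on pairs of distinct slots, so every cross term equals the one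
  -- for the last two slots.
  obtain ⟨σ, hσi, hσj⟩ : ∃ σ : Equiv.Perm (Fin (n + 2)),
      σ (Fin.last (n + 1)) = i ∧ σ (Fin.last n).castSucc = j := by
    refine ⟨(Equiv.swap (Fin.last (n + 1)) i) *
      Equiv.swap (Fin.last n).castSucc (Equiv.swap (Fin.last (n + 1)) i j), ?_, by simp⟩
    rw [Equiv.Perm.mul_apply, Equiv.swap_apply_of_ne_of_ne (a := (Fin.last n).castSucc),
      Equiv.swap_apply_left]
    · exact (Fin.castSucc_lt_last _).ne'
    · intro h
      have := congrArg (Equiv.swap (Fin.last (n + 1)) i) h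
      rw [Equiv.swap_apply_left, Equiv.swap_apply_self] at this
      exact hij this
  have h1 : ∫ x, conj (tensorTerm G ψ i x) * tensorTerm G ψ j x ∂(Measure.pi fun _ => μ) =
      ∫ x, conj (tensorTerm G ψ (Fin.last (n + 1)) x) * tensorTerm G ψ (Fin.last n).castSucc x
        ∂(Measure.pi fun _ => μ) := by
    rw [← (measurePreserving_perm μ σ).integral_comp (measurableEmbedding_perm _) fun x =>
      conj (tensorTerm G ψ (Fin.last (n + 1)) x) * tensorTerm G ψ (Fin.last n).castSucc x]
    refine integral_congr_ae ?_
    filter_upwards [tensorTerm_perm G hsymm σ (Fin.last (n + 1)),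
      tensorTerm_perm G hsymm σ (Fin.last n).castSucc] with x hx hx'
    rw [hx, hx', hσi, hσj]
  have hs2 := measurePreserving_snoc μ (n + 1)
  have hs1 := measurePreserving_snoc μ n
  have hint : Integrable (fun x => conj (tensorTerm G ψ (Fin.last (n + 1)) x) *
      tensorTerm G ψ (Fin.last n).castSucc x) (Measure.pi fun _ => μ) :=
    (memLp_tensorTerm hG hψ (Fin.last (n + 1))).star.integrable_mul (memLp_tensorTerm hG hψ _)
  have hint2 := (hs2.integrable_comp hint.1).2 hint
  rw [h1, ← hs2.map_eq, integral_map hs2.aemeasurable (hs2.map_eq.symm ▸ hint.1)]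
  simp only [Function.comp_def, tensorTerm_last_snoc] at hint2 ⊢
  rw [integral_prod _ hint2]
  have hint3 := hint2.integral_prod_left
  simp only at hint3
  rw [← hs1.map_eq, integral_map hs1.aemeasurable (hs1.map_eq.symm ▸ hint3.1)]
  have hint4 := (hs1.integrable_comp hint3.1).2 hint3
  simp only [Function.comp_def, tensorTerm_castSucc_snoc] at hint4 ⊢
  -- The integrand is now conj(G(q) ψ(z,p)) G(p) ψ(z,q). It separates in p and q, and the double
  -- integral is conj(c) c with c = ∫ conj(G) ψ(z,·).
  rw [integral_prod _ hint4, ← integral_conj_mul_self]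
  · refine integral_congr_ae (Filter.Eventually.of_forall fun z => ?_)
    simp only
    rw [← integral_conj, ← integral_mul_const]
    refine integral_congr_ae (Filter.Eventually.of_forall fun p => ?_)
    simp only
    rw [← integral_const_mul]
    refine integral_congr_ae (Filter.Eventually.of_forall fun q => ?_)
    simp only [map_mul, Complex.conj_conj]
    ring
  · exact ((hG.1.star.comp_quasiMeasurePreserving Measure.quasiMeasurePreserving_snd).mul
      (hψ.1.comp_measurePreserving hs1)).integral_prod_right'

/-- The norm of a symmetrized tensor product, in terms of the one-particle contraction. -/
theorem lintegral_sum_tensorTerm {n : ℕ} {G : M → ℂ} (hG : MemLp G 2 μ)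
    {ψ : (Fin (n + 1) → M) → ℂ} (hψ : MemLp ψ 2 (Measure.pi fun _ => μ))
    (hsymm : ∀ σ : Equiv.Perm (Fin (n + 1)),
      (fun x => ψ fun i => x (σ i)) =ᵐ[Measure.pi fun _ => μ] ψ) :
    ∫⁻ x, ‖∑ i, tensorTerm G ψ i x‖ₑ ^ 2 ∂(Measure.pi fun _ => μ) =
      (n + 2) * ((∫⁻ p, ‖G p‖ₑ ^ 2 ∂μ) * ∫⁻ x, ‖ψ x‖ₑ ^ 2 ∂(Measure.pi fun _ => μ)) +
      (n + 2) * (n + 1) * ∫⁻ z, ‖∫ p, conj (G p) * ψ (Fin.snoc (α := fun _ => M) z p) ∂μ‖ₑ ^ 2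
        ∂(Measure.pi fun _ : Fin n => μ) := by
  have hG' := (memLp_two_iff_lintegral.1 hG)
  have hψ' := (memLp_two_iff_lintegral.1 hψ)
  have hT := memLp_tensorTerm hG hψ
  have hA : MemLp (fun x => ∑ i, tensorTerm G ψ i x) 2 (Measure.pi fun _ => μ) :=
    memLp_finsetSum _ fun i _ => hT i
  have hfin : ∫⁻ z, ‖∫ p, conj (G p) * ψ (Fin.snoc (α := fun _ => M) z p) ∂μ‖ₑ ^ 2
      ∂(Measure.pi fun _ : Fin n => μ) < ∞ := by
    have hψs := hψ.1.comp_measurePreserving (measurePreserving_snoc μ n)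
    refine lt_of_le_of_lt (lintegral_mono_ae (hψs.prodMk_left.mono fun z hz =>
      enorm_integral_mul_sq_le hG.1.star hz)) ?_
    rw [lintegral_const_mul'' _ ?_, ← lintegral_snoc (hψ.1.enorm.pow_const 2)]
    · refine ENNReal.mul_lt_top ?_ hψ'.2
      simpa using hG'.2
    · exact (hψs.enorm.pow_const 2).lintegral_prod_right'
  have hn : (n + 2 : ℝ≥0∞) ≠ ∞ := by finiteness
  have h1 := ENNReal.mul_ne_top hn (ENNReal.mul_lt_top hG'.2 hψ'.2).ne
  have h2 := ENNReal.mul_ne_top (ENNReal.mul_ne_top hn (by finiteness : (n + 1 : ℝ≥0∞) ≠ ∞)) hfin.ne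
  -- Both sides are finite, so the square can be expanded as a complex integral. Each of the n+2
  -- rows has one diagonal term and n+1 equal cross terms.
  rw [← ENNReal.toReal_eq_toReal_iff' (memLp_two_iff_lintegral.1 hA).2.ne]
  · rw [← Complex.ofReal_inj, ← integral_conj_mul_self hA.1]
    simp_rw [map_sum, Finset.sum_mul_sum]
    have hint (i j : Fin (n + 2)) : Integrable
        (fun x => conj (tensorTerm G ψ i x) * tensorTerm G ψ j x) (Measure.pi fun _ => μ) :=
      (hT i).star.integrable_mul (hT j)
    rw [integral_finsetSum _ fun i _ => integrable_finsetSum _ fun j _ => hint i j]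
    have hrow (i : Fin (n + 2)) : ∫ x, ∑ j, conj (tensorTerm G ψ i x) * tensorTerm G ψ j x
        ∂(Measure.pi fun _ => μ) =
        (((∫⁻ p, ‖G p‖ₑ ^ 2 ∂μ) * ∫⁻ x, ‖ψ x‖ₑ ^ 2 ∂(Measure.pi fun _ => μ)).toReal : ℂ) +
        (n + 1) * ((∫⁻ z, ‖∫ p, conj (G p) * ψ (Fin.snoc (α := fun _ => M) z p) ∂μ‖ₑ ^ 2
          ∂(Measure.pi fun _ : Fin n => μ)).toReal : ℂ) := by
      rw [integral_finsetSum _ fun j _ => hint i j,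
        ← Finset.add_sum_erase _ _ (Finset.mem_univ i), integral_conj_mul_self (hT i).1,
        lintegral_tensorTerm hG.1 hψ.1,
        Finset.sum_congr rfl fun j hj =>
          integral_conj_tensorTerm_mul hG hψ hsymm (Finset.ne_of_mem_erase hj).symm]
      simp
    simp_rw [hrow]
    rw [ENNReal.toReal_add h1 h2]
    simp [ENNReal.toReal_mul, ENNReal.toReal_add]
    ring
  · exact ENNReal.add_ne_top.2 ⟨h1, h2⟩

end Configurations
end FieldEnergy

namespace FieldEnergy

open Filter Topology
open scoped ContDiff

/-! ### Plancherel's identity for Fourier integrals -/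

section Plancherel

/-- For an integrable and square integrable function, the `L²` Fourier transform is given by the
Fourier integral. -/
theorem fourier_toLp_ae_eq {V : Type*} [NormedAddCommGroup V] [InnerProductSpace ℝ V]
    [FiniteDimensional ℝ V] [MeasurableSpace V] [BorelSpace V] {h : V → ℂ}
    (h1 : Integrable h) (h2 : MemLp h 2) :
    (𝓕 (h2.toLp h) : Lp (α := V) ℂ 2) =ᵐ[volume] 𝓕 h := by
  have hcont : Continuous (𝓕 h) := VectorFourier.fourierIntegral_continuous
    Real.continuous_fourierChar (innerSL ℝ).continuous₂ h1
  -- Testing against smooth `g` of compact support suffices. The L² transform is also the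
  -- distributional one, so the transform moves onto the test function, and Fubini moves it back
  -- onto `h`.
  refine ae_eq_of_integral_contDiff_smul_eq
    ((Lp.memLp _).locallyIntegrable one_le_two) hcont.locallyIntegrable fun g hg hgc => ?_
  have hg₁ : HasCompactSupport (Complex.ofRealCLM ∘ g) := hgc.comp_left rfl
  have hg₂ : ContDiff ℝ ∞ (Complex.ofRealCLM ∘ g) := by fun_prop
  set φ := hg₁.toSchwartzMap hg₂ with hφ
  have e1 := congrArg (fun T : 𝓢'(V, ℂ) => T φ) (Lp.fourier_toTemperedDistribution_eq (h2.toLp h))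
  simp only [TemperedDistribution.fourier_apply, Lp.toTemperedDistribution_apply] at e1
  calc ∫ x, g x • (𝓕 (h2.toLp h) : Lp ℂ 2 (volume : Measure V)) x
      = ∫ x, φ x • (𝓕 (h2.toLp h) : Lp ℂ 2 (volume : Measure V)) x := by simp [hφ]
    _ = ∫ x, (𝓕 φ) x • (h2.toLp h) x := e1.symm
    _ = ∫ x, (𝓕 φ) x • h x := by
        refine integral_congr_ae ?_
        filter_upwards [h2.coeFn_toLp] with x hx
        rw [hx]
    _ = ∫ x, φ x • 𝓕 h x := by
        rw [SchwartzMap.fourier_coe]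
        have := VectorFourier.integral_fourierIntegral_smul_eq_flip (L := innerₗ V)
          Real.continuous_fourierChar (innerSL ℝ).continuous₂ (φ.integrable (μ := volume)) h1
        rwa [flip_innerₗ] at this
    _ = ∫ x, g x • 𝓕 h x := rfl

theorem lintegral_fourier_sq {V : Type*} [NormedAddCommGroup V] [InnerProductSpace ℝ V]
    [FiniteDimensional ℝ V] [MeasurableSpace V] [BorelSpace V] {h : V → ℂ}
    (h1 : Integrable h) (h2 : MemLp h 2) :
    ∫⁻ y, ‖𝓕 h y‖ₑ ^ 2 = ∫⁻ x, ‖h x‖ₑ ^ 2 := by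
  rw [← eLpNorm_two_sq, ← eLpNorm_two_sq, ← eLpNorm_congr_ae (fourier_toLp_ae_eq h1 h2),
    ← Lp.enorm_def, ← eLpNorm_congr_ae h2.coeFn_toLp, ← Lp.enorm_def, ← ofReal_norm,
    Lp.norm_fourier_eq, ofReal_norm]

/-- `𝓕` has the kernel e^{-2πi x·y}; the dilation by -1/(2π) passes to e^{ik·y}, and its Jacobian is
the (2π)³ of `lintegral_planeWave_sq`. -/
theorem fourier_smul_eq (h : R3 → ℂ) (y : R3) :
    𝓕 h ((-(2 * Real.pi)⁻¹ : ℝ) • y) = ∫ k, h k * Complex.exp (Complex.I * (inner ℝ k y : ℝ)) := by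
  rw [Real.fourier_eq']
  refine integral_congr_ae (Eventually.of_forall fun k => ?_)
  simp only [inner_smul_right, smul_eq_mul]
  rw [mul_comm]
  congr 2
  have : (Real.pi : ℂ) ≠ 0 := by exact_mod_cast Real.pi_ne_zero
  push_cast
  field_simp

/-- Plancherel's identity for the unnormalized Fourier integral. -/
theorem lintegral_planeWave_sq {h : R3 → ℂ} (h1 : Integrable h) (h2 : MemLp h 2) :
    ∫⁻ y, ‖∫ k, h k * Complex.exp (Complex.I * (inner ℝ k y : ℝ))‖ₑ ^ 2 =
      ENNReal.ofReal ((2 * Real.pi) ^ 3) * ∫⁻ k, ‖h k‖ₑ ^ 2 := by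
  have hcont : Continuous (𝓕 h) := VectorFourier.fourierIntegral_continuous
    Real.continuous_fourierChar (innerSL ℝ).continuous₂ h1
  have hr : (-(2 * Real.pi)⁻¹ : ℝ) ≠ 0 := by
    have := Real.pi_pos
    simp [this.ne']
  simp_rw [← fourier_smul_eq]
  have hmeas : Measurable fun y => ‖𝓕 h y‖ₑ ^ 2 := by fun_prop
  rw [← lintegral_fourier_sq h1 h2,
    ← lintegral_map hmeas (measurable_const_smul (-(2 * Real.pi)⁻¹ : ℝ)),
    Measure.map_addHaar_smul _ hr, lintegral_smul_measure]
  congr 2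
  have := Real.pi_pos
  simp only [finrank_euclideanSpace, Fintype.card_fin]
  rw [abs_inv, abs_pow, abs_neg, abs_of_pos (by positivity), inv_pow, inv_inv]

end Plancherel

/-! ### Density of test functions in L² of an open set -/

section Density

variable {V : Type*} [NormedAddCommGroup V] [NormedSpace ℝ V] [FiniteDimensional ℝ V]
  [MeasurableSpace V] [BorelSpace V] (ν : Measure V) [IsLocallyFiniteMeasure ν]

/-- Smooth functions with compact support in `U`. -/
structure IsTestFunction (U : Set V) (χ : V → ℂ) : Prop where
  contDiff : ContDiff ℝ ∞ χ
  compact : HasCompactSupport χ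
  tsupport_subset : tsupport χ ⊆ U

theorem IsTestFunction.memLp {U : Set V} {χ : V → ℂ} (h : IsTestFunction U χ) :
    MemLp χ 2 ν := h.contDiff.continuous.memLp_of_hasCompactSupport h.compact

/-- The test functions in `U` as a subspace of `L²(U)`. -/
def testSubmodule (U : Set V) : Submodule ℂ (Lp ℂ 2 (ν.restrict U)) where
  carrier := {f | ∃ χ, IsTestFunction U χ ∧ f =ᵐ[ν.restrict U] χ}
  zero_mem' := ⟨0, ⟨contDiff_const, HasCompactSupport.zero, by simp⟩, Lp.coeFn_zero _ _ _⟩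
  add_mem' := by
    rintro f g ⟨χ, hχ, hf⟩ ⟨η, hη, hg⟩
    exact ⟨χ + η, ⟨hχ.contDiff.add hη.contDiff, hχ.compact.add hη.compact,
      (tsupport_add χ η).trans (Set.union_subset hχ.tsupport_subset hη.tsupport_subset)⟩,
      (Lp.coeFn_add f g).trans (hf.add hg)⟩
  smul_mem' := by
    rintro c f ⟨χ, hχ, hf⟩
    exact ⟨c • χ, ⟨contDiff_const.smul hχ.contDiff, hχ.compact.smul_left (f := fun _ => c),
      (tsupport_smul_subset_right (fun _ => c) χ).trans hχ.tsupport_subset⟩,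
      (Lp.coeFn_smul c f).trans (hf.const_smul c)⟩

/-- The fundamental lemma of the calculus of variations; it amounts to density of the test
functions. -/
theorem testSubmodule_orthogonal {U : Set V} (hU : IsOpen U) : (testSubmodule ν U)ᗮ = ⊥ := by
  rw [Submodule.eq_bot_iff]
  intro h hh
  rw [Submodule.mem_orthogonal] at hh
  have hloc : LocallyIntegrableOn h U ν :=
    locallyIntegrableOn_of_locallyIntegrable_restrict
      ((Lp.memLp h).locallyIntegrable one_le_two)
  have key := hU.ae_eq_zero_of_integral_contDiff_smul_eq_zero hloc fun g hg hgc hgU => by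
    have hχ : IsTestFunction U (fun x => (g x : ℂ)) :=
      ⟨Complex.ofRealCLM.contDiff.comp hg, hgc.comp_left Complex.ofReal_zero,
        (closure_mono fun x hx => by simpa using hx).trans hgU⟩
    have hL := (hχ.memLp ν).restrict U
    have := hh (hL.toLp _) ⟨_, hχ, hL.coeFn_toLp⟩
    rw [L2.inner_def] at this
    have h2 : ∫ x in U, g x • h x ∂ν = 0 := by
      rw [← this]
      refine integral_congr_ae ?_
      filter_upwards [hL.coeFn_toLp] with x hx
      rw [hx]
      simp [mul_comm]
    rw [← h2, setIntegral_eq_integral_of_forall_compl_eq_zero]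
    intro x hx
    rw [image_eq_zero_of_notMem_tsupport fun hx' => hx (hgU hx'), zero_smul]
  rw [Lp.eq_zero_iff_ae_eq_zero]
  exact (ae_restrict_iff' hU.measurableSet).2 key

theorem exists_testFunction_tendsto {U : Set V} (hU : IsOpen U) {f : V → ℂ}
    (hf : MemLp f 2 (ν.restrict U)) :
    ∃ χ : ℕ → V → ℂ, (∀ n, IsTestFunction U (χ n)) ∧
      Tendsto (fun n => eLpNorm (χ n - f) 2 (ν.restrict U)) atTop (𝓝 0) := by
  have hd : hf.toLp f ∈ (testSubmodule ν U).topologicalClosure := by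
    rw [(testSubmodule ν U).topologicalClosure_eq_top_iff.2 (testSubmodule_orthogonal ν hU)]
    trivial
  obtain ⟨g, hg, hgt⟩ := mem_closure_iff_seq_limit.1 hd
  choose χ hχ hgχ using hg
  refine ⟨χ, hχ, ?_⟩
  refine ((Lp.tendsto_Lp_iff_tendsto_eLpNorm g f hf).1 hgt).congr fun n => ?_
  exact eLpNorm_congr_ae ((hgχ n).sub .rfl)

end Density

end FieldEnergy

namespace FieldEnergy

open Filter Topology
open scoped ContDiff

/-! ### Extending one-particle bounds from test functions to L² -/

section Closure

theorem enorm_integral_mul_le {α : Type*} [MeasurableSpace α] {ν : Measure α} {f g : α → ℂ}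
    (hf : AEStronglyMeasurable f ν) (hg : AEStronglyMeasurable g ν) :
    ‖∫ x, f x * g x ∂ν‖ₑ ≤ eLpNorm f 2 ν * eLpNorm g 2 ν := by
  have h := enorm_integral_mul_sq_le hf hg
  rw [← eLpNorm_two_sq, ← eLpNorm_two_sq, ← mul_pow] at h
  exact (ENNReal.pow_le_pow_left_iff two_ne_zero).1 h

theorem ofReal_norm_mul_enorm_sq (k : R3) (z : ℂ) :
    ENNReal.ofReal ‖k‖ * ‖z‖ₑ ^ 2 = ‖(Real.sqrt ‖k‖ : ℂ) * z‖ₑ ^ 2 := by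
  rw [enorm_mul, mul_pow, ← ofReal_norm (Real.sqrt ‖k‖ : ℂ), ← ENNReal.ofReal_pow (norm_nonneg _),
    Complex.norm_real, Real.norm_eq_abs, sq_abs, Real.sq_sqrt (norm_nonneg k)]

theorem enorm_exp_I_mul (t : ℝ) : ‖Complex.exp (Complex.I * (t : ℂ))‖ₑ = 1 := by
  rw [mul_comm, ← ofReal_norm, Complex.norm_exp_ofReal_mul_I, ENNReal.ofReal_one]

theorem aestronglyMeasurable_mul_planeWave {ν : Measure R3} {h : R3 → ℂ}
    (hh : AEStronglyMeasurable h ν) (y : R3) :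
    AEStronglyMeasurable (fun k => h k * Complex.exp (Complex.I * (inner ℝ k y : ℝ))) ν :=
  hh.mul (by fun_prop : Continuous fun k : R3 =>
    Complex.exp (Complex.I * (inner ℝ k y : ℝ))).aestronglyMeasurable

theorem eLpNorm_mul_planeWave {ν : Measure R3} (h : R3 → ℂ) (y : R3) :
    eLpNorm (fun k => h k * Complex.exp (Complex.I * (inner ℝ k y : ℝ))) 2 ν = eLpNorm h 2 ν :=
  eLpNorm_congr_enorm_ae (Eventually.of_forall fun k => by rw [enorm_mul, enorm_exp_I_mul, mul_one])

theorem memLp_mul_planeWave {ν : Measure R3} {h : R3 → ℂ} (hh : MemLp h 2 ν) (y : R3) :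
    MemLp (fun k => h k * Complex.exp (Complex.I * (inner ℝ k y : ℝ))) 2 ν :=
  ⟨aestronglyMeasurable_mul_planeWave hh.1 y, (eLpNorm_mul_planeWave h y).trans_lt hh.2⟩

theorem aestronglyMeasurable_integral_planeWave {ν : Measure R3} [SFinite ν] {h g : R3 → ℂ}
    (hh : AEStronglyMeasurable h ν) (hg : AEStronglyMeasurable g ν) :
    AEStronglyMeasurable (fun y : R3 =>
      ∫ k, h k * Complex.exp (Complex.I * (inner ℝ k y : ℝ)) * g k ∂ν) volume := by
  have h1 : AEStronglyMeasurable (fun q : R3 × R3 =>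
      h q.2 * Complex.exp (Complex.I * (inner ℝ q.2 q.1 : ℝ)) * g q.2) (volume.prod ν) :=
    (hh.comp_snd.mul (by fun_prop : Continuous fun q : R3 × R3 =>
      Complex.exp (Complex.I * (inner ℝ q.2 q.1 : ℝ))).aestronglyMeasurable).mul hg.comp_snd
  exact h1.integral_prod_right'

theorem tendsto_integral_mul_of_eLpNorm {α : Type*} [MeasurableSpace α] {ν : Measure α}
    {f g : α → ℂ} {χ : ℕ → α → ℂ} (hf : MemLp f 2 ν) (hg : MemLp g 2 ν)
    (hχ : ∀ n, MemLp (χ n) 2 ν)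
    (hlim : Tendsto (fun n => eLpNorm (χ n - g) 2 ν) atTop (𝓝 0)) :
    Tendsto (fun n => ∫ x, f x * χ n x ∂ν) atTop (𝓝 (∫ x, f x * g x ∂ν)) := by
  rw [tendsto_iff_edist_tendsto_0]
  have h0 : Tendsto (fun n => eLpNorm f 2 ν * eLpNorm (χ n - g) 2 ν) atTop (𝓝 0) := by
    simpa using ENNReal.Tendsto.const_mul hlim (Or.inr hf.2.ne)
  refine tendsto_of_tendsto_of_tendsto_of_le_of_le tendsto_const_nhds h0 (fun _ => zero_le) ?_
  intro n
  simp only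
  rw [edist_eq_enorm_sub]
  have := integral_sub (hf.integrable_mul (hχ n)) (hf.integrable_mul hg)
  simp only [Pi.mul_apply] at this
  rw [← this]
  simp_rw [← mul_sub]
  exact enorm_integral_mul_le hf.1 ((hχ n).1.sub hg.1)

/-- A weighted square integral bound for the functions `∑_l ∫_U A_{l,j}(k) e^{i k·y} χ_l(k) dk`
extends from test functions to square integrable functions. -/
theorem tsum_lintegral_planeWave_le {J : Type*} [Countable J] {U : Set R3} (hU : IsOpen U) {C : ℝ}
    (hC : ∀ k ∈ U, ‖k‖ ≤ C) {w : R3 → ℝ≥0∞} (hw : AEMeasurable w)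
    (hwt : ∀ y, w y ≠ ⊤) {A : Fin 2 → J → R3 → ℂ}
    (hA : ∀ l j, MemLp (A l j) 2 (volume.restrict U))
    (bound : ∀ χ : Fin 2 → R3 → ℂ, (∀ l, IsTestFunction U (χ l)) →
      ∑' j, ∫⁻ y, ‖∑ l, ∫ k in U,
        A l j k * Complex.exp (Complex.I * (inner ℝ k y : ℝ)) * χ l k‖ₑ ^ 2 * w y ≤
      ∑ l, ∫⁻ k in U, ENNReal.ofReal ‖k‖ * ‖χ l k‖ₑ ^ 2)
    {ψ : Fin 2 → R3 → ℂ} (hψ : ∀ l, MemLp (ψ l) 2 (volume.restrict U)) :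
    ∑' j, ∫⁻ y, ‖∑ l, ∫ k in U,
        A l j k * Complex.exp (Complex.I * (inner ℝ k y : ℝ)) * ψ l k‖ₑ ^ 2 * w y ≤
      ∑ l, ∫⁻ k in U, ENNReal.ofReal ‖k‖ * ‖ψ l k‖ₑ ^ 2 := by
  choose χ hχ hlim using fun l => exists_testFunction_tendsto volume hU (hψ l)
  have hχL (l : Fin 2) (n : ℕ) := ((hχ l n).memLp volume).restrict U
  let F (n : ℕ) (j : J) (y : R3) : ℝ≥0∞ := ‖∑ l, ∫ k in U,
    A l j k * Complex.exp (Complex.I * (inner ℝ k y : ℝ)) * χ l n k‖ₑ ^ 2 * w y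
  have hF (n : ℕ) (j : J) : AEMeasurable (F n j) := by
    refine (AEStronglyMeasurable.enorm ?_).pow_const 2 |>.mul hw
    exact Finset.aestronglyMeasurable_fun_sum _ fun l _ =>
      aestronglyMeasurable_integral_planeWave (hA l j).1 (hχL l n).1
  -- For fixed y the inner integral is a continuous functional of ψ in L², since `A l j` is square
  -- integrable.
  have hFlim (j : J) (y : R3) : ‖∑ l, ∫ k in U,
      A l j k * Complex.exp (Complex.I * (inner ℝ k y : ℝ)) * ψ l k‖ₑ ^ 2 * w y ≤
      liminf (fun n => F n j y) atTop := by
    have h1 : Tendsto (fun n => ‖∑ l, ∫ k in U,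
        A l j k * Complex.exp (Complex.I * (inner ℝ k y : ℝ)) * χ l n k‖ₑ ^ 2) atTop
        (𝓝 (‖∑ l, ∫ k in U,
          A l j k * Complex.exp (Complex.I * (inner ℝ k y : ℝ)) * ψ l k‖ₑ ^ 2)) := by
      refine ENNReal.Tendsto.pow (Tendsto.enorm (tendsto_finsetSum _ fun l _ => ?_))
      exact tendsto_integral_mul_of_eLpNorm (memLp_mul_planeWave (hA l j) y) (hψ l) (hχL l) (hlim l)
    exact (ENNReal.Tendsto.mul_const h1 (Or.inr (hwt y))).liminf_eq.ge
  have hs : AEStronglyMeasurable (fun k : R3 => (Real.sqrt ‖k‖ : ℂ)) (volume.restrict U) :=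
    (by fun_prop : Continuous fun k : R3 => (Real.sqrt ‖k‖ : ℂ)).aestronglyMeasurable
  let a (l : Fin 2) := eLpNorm (fun k => (Real.sqrt ‖k‖ : ℂ) * ψ l k) 2 (volume.restrict U)
  let δ (n : ℕ) (l : Fin 2) :=
    ENNReal.ofReal (Real.sqrt C) * eLpNorm (χ l n - ψ l) 2 (volume.restrict U)
  -- Multiplication by √|k| is bounded on U, so L² convergence of χ carries over to the energy norm
  -- on the right.
  have hR (n : ℕ) (l : Fin 2) : ∫⁻ k in U, ENNReal.ofReal ‖k‖ * ‖χ l n k‖ₑ ^ 2 ≤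
      (a l + δ n l) ^ 2 := by
    simp_rw [ofReal_norm_mul_enorm_sq, ← eLpNorm_two_sq]
    gcongr
    have e : (fun k => (Real.sqrt ‖k‖ : ℂ) * χ l n k) = (fun k => (Real.sqrt ‖k‖ : ℂ) * ψ l k) +
        fun k => (Real.sqrt ‖k‖ : ℂ) * (χ l n - ψ l) k := by
      funext k; simp [mul_sub]
    have hd := (hχL l n).1.sub (hψ l).1
    rw [e]
    refine (eLpNorm_add_le (hs.mul (hψ l).1) (hs.mul hd) one_le_two).trans (add_le_add le_rfl ?_)
    refine eLpNorm_le_mul_eLpNorm_of_ae_le_mul ?_ _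
    filter_upwards [ae_restrict_mem hU.measurableSet] with k hk
    rw [Pi.mul_apply, norm_mul, Complex.norm_real, Real.norm_of_nonneg (Real.sqrt_nonneg _)]
    gcongr
    exact hC k hk
  have hRlim : Tendsto (fun n => ∑ l, (a l + δ n l) ^ 2) atTop (𝓝 (∑ l, a l ^ 2)) := by
    refine tendsto_finsetSum _ fun l _ => ENNReal.Tendsto.pow ?_
    have h0 : Tendsto (fun n => δ n l) atTop (𝓝 0) := by
      simpa using ENNReal.Tendsto.const_mul (hlim l)
        (Or.inr (ENNReal.ofReal_ne_top (r := Real.sqrt C)))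
    simpa using h0.const_add (a l)
  -- Fatou's lemma twice: for the integral over y, then for the sum over j as a counting integral.
  calc ∑' j, ∫⁻ y, ‖∑ l, ∫ k in U,
        A l j k * Complex.exp (Complex.I * (inner ℝ k y : ℝ)) * ψ l k‖ₑ ^ 2 * w y
      ≤ ∑' j, liminf (fun n => ∫⁻ y, F n j y) atTop := by
        refine ENNReal.tsum_le_tsum fun j => ?_
        exact (lintegral_mono fun y => hFlim j y).trans (lintegral_liminf_le' fun n => hF n j)
    _ ≤ liminf (fun n => ∑' j, ∫⁻ y, F n j y) atTop := by
        let _ : MeasurableSpace J := ⊤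
        simp_rw [← lintegral_count]
        exact lintegral_liminf_le fun n => measurable_from_top
    _ ≤ liminf (fun n => ∑ l, (a l + δ n l) ^ 2) atTop := by
        refine liminf_le_liminf (Eventually.of_forall fun n => ?_)
        exact (bound (fun l => χ l n) fun l => hχ l n).trans (Finset.sum_le_sum fun l _ => hR n l)
    _ = ∑ l, a l ^ 2 := hRlim.liminf_eq
    _ = _ := by simp_rw [ofReal_norm_mul_enorm_sq, a, eLpNorm_two_sq]

end Closure

end FieldEnergy

namespace FieldEnergy

open Filter Topology
open scoped ContDiff

/-! ### The weight norm in momentum space -/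

section WeightNorm

theorem contDiff_planeWave (y : R3) :
    ContDiff ℝ ∞ fun k : R3 => Complex.exp (Complex.I * (inner ℝ k y : ℝ)) :=
  Complex.contDiff_exp.comp (contDiff_const.mul (Complex.ofRealCLM.contDiff.comp
    (contDiff_id.inner ℝ contDiff_const)))

/-- The Schwartz function `z ↦ (2π)^(-3/2) ∫ φ(k) e^{i k·z} dk`. -/
noncomputable def schwartzFourierInv (φ : 𝓢(R3, ℂ)) : 𝓢(R3, ℂ) :=
  compCLMOfContinuousLinearEquiv ℂ (ContinuousLinearEquiv.neg ℝ (M := R3)) (schwartzFourier φ)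

theorem schwartzFourierInv_apply (φ : 𝓢(R3, ℂ)) (z : R3) :
    schwartzFourierInv φ z = (((2 * Real.pi) ^ (-(3 / 2) : ℝ) : ℝ) : ℂ) *
      ∫ k : R3, φ k * Complex.exp (Complex.I * (inner ℝ k z : ℝ)) := by
  change schwartzFourier φ (-z) = _
  simp [schwartzFourier_apply]

theorem lintegral_schwartzFourierInv_sq (φ : 𝓢(R3, ℂ)) :
    ∫⁻ z, ‖schwartzFourierInv φ z‖ₑ ^ 2 = ∫⁻ k, ‖φ k‖ₑ ^ 2 := by
  have hpi : (0 : ℝ) < 2 * Real.pi := by positivity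
  simp_rw [schwartzFourierInv_apply, enorm_mul, mul_pow]
  rw [lintegral_const_mul' _ _ (by finiteness),
    lintegral_planeWave_sq φ.integrable (φ.memLp 2), ← mul_assoc, ← ofReal_norm,
    Complex.norm_real, Real.norm_of_nonneg (by positivity), ← ENNReal.ofReal_pow (by positivity),
    ← ENNReal.ofReal_mul (by positivity), ← Real.rpow_natCast, ← Real.rpow_natCast,
    ← Real.rpow_mul hpi.le, ← Real.rpow_add hpi]
  norm_num

/-- The convolution of the inverse Fourier transform of `F` with `v` is the inverse Fourier
transform of `F` times the Fourier transform of `v`, up to normalization. -/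
theorem conv_schwartzFourierInv {vhat : R3 → ℂ} {v : 𝓢'(R3, ℂ)} (hv : IsFourierTransformOf vhat v)
    {F : R3 → ℂ} (hF : HasCompactSupport F) (hFs : ContDiff ℝ ∞ F) (y : R3) :
    conv (schwartzFourierInv (hF.toSchwartzMap hFs)) v y =
      ∫ k, vhat k * (F k * Complex.exp (Complex.I * (inner ℝ k y : ℝ))) := by
  have hφ : HasCompactSupport fun k => F k * Complex.exp (Complex.I * (inner ℝ k y : ℝ)) :=
    hF.mul_right
  -- In e^{ik·(y-z)} = e^{ik·y} e^{-ik·z} the first factor joins F and the second is the kernel of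
  -- the Fourier transform.
  have h : reflectTranslate (schwartzFourierInv (hF.toSchwartzMap hFs)) y =
      schwartzFourier (hφ.toSchwartzMap (hFs.mul (contDiff_planeWave y))) := by
    ext z
    rw [reflectTranslate_apply, schwartzFourierInv_apply, schwartzFourier_apply]
    congr 1
    refine integral_congr_ae (Eventually.of_forall fun k => ?_)
    simp only [HasCompactSupport.toSchwartzMap_toFun, inner_sub_right]
    rw [mul_assoc, ← Complex.exp_add]
    congr 2
    push_cast
    ring
  rw [conv, h, (hv _).2]
  rfl

theorem le_of_weightNorm_le_one {J : Set ℤ} {v : Fin 2 → J → 𝓢'(R3, ℂ)} {w : R3 → ℝ}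
    (h : weightNorm v w ≤ 1) (f : Fin 2 → 𝓢(R3, ℂ)) :
    ∑' j : J, ∫⁻ x, ‖∑ l, conv (f l) (v l j) x‖ₑ ^ 2 * ‖w x‖ₑ ≤ ∑ l, ∫⁻ x, ‖f l x‖ₑ ^ 2 := by
  have h1 := (le_iSup (fun f : Fin 2 → 𝓢(R3, ℂ) =>
    (∑' j : J, ∫⁻ x, ‖∑ l, conv (f l) (v l j) x‖ₑ ^ 2 * ‖w x‖ₑ) /
      (∑ l, ∫⁻ x, ‖f l x‖ₑ ^ 2)) f).trans h
  -- A zero denominator is harmless: a / 0 = ∞ for a ≠ 0, so a quotient at most 1 forces a = 0.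
  simpa using (ENNReal.div_le_iff_le_mul (by simp) (by simp)).1 h1

/-- √|k| is smooth away from the origin, and χ vanishes near it. -/
theorem contDiff_sqrt_norm_mul {U : Set R3} (h0 : (0 : R3) ∉ U) {χ : R3 → ℂ}
    (hχ : IsTestFunction U χ) : ContDiff ℝ ∞ fun k => (Real.sqrt ‖k‖ : ℂ) * χ k := by
  rw [contDiff_iff_contDiffAt]
  intro k
  by_cases hk : k = 0
  · have h : (fun k => (Real.sqrt ‖k‖ : ℂ) * χ k) =ᶠ[𝓝 k] fun _ => 0 := by
      have h1 := notMem_tsupport_iff_eventuallyEq.1 fun hk' => h0 (hk ▸ hχ.tsupport_subset hk')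
      filter_upwards [h1] with z hz
      simp [hz]
    exact contDiffAt_const.congr_of_eventuallyEq h
  · have h1 : ContDiffAt ℝ ∞ (fun k : R3 => Real.sqrt ‖k‖) k :=
      (contDiffAt_norm ℝ hk).sqrt (norm_ne_zero_iff.2 hk)
    exact (Complex.ofRealCLM.contDiff.contDiffAt.comp k h1).mul hχ.contDiff.contDiffAt

/-- The bound expressed by `weightNorm v w ≤ 1`, for functions of the momentum. -/
theorem tsum_lintegral_planeWave_le_of_weightNorm {Λ : ℝ} {J : Set ℤ} {v : Fin 2 → J → 𝓢'(R3, ℂ)}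
    {vhat : Fin 2 → J → R3 → ℂ} {w : R3 → ℝ} (hv : ∀ l j, IsFourierTransformOf (vhat l j) (v l j))
    (hw : Integrable w) (h : weightNorm v w ≤ 1)
    (hA : ∀ l j, MemLp (fun k => (Real.sqrt ‖k‖ : ℂ) * vhat l j k) 2
      (volume.restrict (Metric.ball 0 Λ)))
    {ψ : Fin 2 → R3 → ℂ} (hψ : ∀ l, MemLp (ψ l) 2 (volume.restrict (Metric.ball 0 Λ))) :
    ∑' j, ∫⁻ y, ‖∑ l, ∫ k in Metric.ball 0 Λ, (Real.sqrt ‖k‖ : ℂ) * vhat l j k *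
        Complex.exp (Complex.I * (inner ℝ k y : ℝ)) * ψ l k‖ₑ ^ 2 * ‖w y‖ₑ ≤
      ∑ l, ∫⁻ k in Metric.ball 0 Λ, ENNReal.ofReal ‖k‖ * ‖ψ l k‖ₑ ^ 2 := by
  -- The origin is a null set. Once it is removed, √|k| χ_λ is smooth with compact support, hence
  -- the Fourier transform of an admissible f_λ.
  have hU : IsOpen (Metric.ball (0 : R3) Λ \ {0}) := Metric.isOpen_ball.sdiff isClosed_singleton
  have hres : (volume : Measure R3).restrict (Metric.ball 0 Λ) =
      volume.restrict (Metric.ball 0 Λ \ {0}) := by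
    refine (Measure.restrict_congr_set ?_).symm
    exact sdiff_null_ae_eq_self (by simp)
  simp_rw [hres] at hA hψ ⊢
  refine tsum_lintegral_planeWave_le hU (C := Λ) (fun k hk => (mem_ball_zero_iff.1 hk.1).le)
    hw.1.enorm (by simp) hA (fun χ hχ => ?_) hψ
  have hF (l : Fin 2) : HasCompactSupport fun k => (Real.sqrt ‖k‖ : ℂ) * χ l k :=
    (hχ l).compact.mul_left
  have hFs (l : Fin 2) := contDiff_sqrt_norm_mul (fun h => h.2 rfl) (hχ l)
  have hzero (l : Fin 2) {k : R3} (hk : k ∉ Metric.ball (0 : R3) Λ \ {0}) : χ l k = 0 :=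
    image_eq_zero_of_notMem_tsupport fun h => hk ((hχ l).tsupport_subset h)
  have key := le_of_weightNorm_le_one h fun l =>
    schwartzFourierInv ((hF l).toSchwartzMap (hFs l))
  simp_rw [conv_schwartzFourierInv (hv _ _) (hF _) (hFs _), lintegral_schwartzFourierInv_sq] at key
  refine (le_of_eq ?_).trans (key.trans (le_of_eq ?_))
  · refine tsum_congr fun j => lintegral_congr fun y => ?_
    congr 3
    refine Finset.sum_congr rfl fun l _ => ?_
    rw [setIntegral_eq_integral_of_forall_compl_eq_zero fun k hk => by rw [hzero l hk, mul_zero]]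
    refine integral_congr_ae (Eventually.of_forall fun k => ?_)
    simp only
    ring
  · refine Finset.sum_congr rfl fun l _ => ?_
    simp_rw [ofReal_norm_mul_enorm_sq]
    rw [setLIntegral_eq_of_support_subset]
    · rfl
    · exact fun k hk => by_contra fun hk' => hk (by simp [hzero l hk'])

end WeightNorm

end FieldEnergy

namespace FieldEnergy

open Filter Topology

/-! ### Integration over photon modes -/

section Modes

instance : SigmaFinite modeMeasure := inferInstanceAs (SigmaFinite (volume.prod Measure.count))

instance (n : ℕ) : SigmaFinite (photonMeasure n) :=
  inferInstanceAs (SigmaFinite (Measure.pi fun _ => modeMeasure))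

theorem lintegral_modeMeasure {f : Mode → ℝ≥0∞} (hf : AEMeasurable f modeMeasure) :
    ∫⁻ p, f p ∂modeMeasure = ∑ l, ∫⁻ k, f (k, l) := by
  rw [modeMeasure, lintegral_prod_symm f hf, lintegral_count, tsum_fintype]

/-- Counting measure charges each polarization, so a null set of modes has null slices. -/
theorem quasiMeasurePreserving_mode (l : Fin 2) :
    Measure.QuasiMeasurePreserving (fun k : R3 => ((k, l) : Mode)) volume modeMeasure := by
  refine ⟨by fun_prop, Measure.AbsolutelyContinuous.mk fun s hs h0 => ?_⟩
  rw [modeMeasure, Measure.prod_apply_symm hs, lintegral_count, tsum_fintype] at h0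
  rw [Measure.map_apply (by fun_prop) hs]
  exact (Finset.sum_eq_zero_iff.1 h0) l (Finset.mem_univ l)

theorem integral_modeMeasure {f : Mode → ℂ} (hf : Integrable f modeMeasure) :
    ∫ p, f p ∂modeMeasure = ∑ l, ∫ k, f (k, l) := by
  rw [modeMeasure, integral_prod_symm f hf, integral_fintype Integrable.of_finite]
  simp [Measure.real]

theorem aestronglyMeasurable_mode {G : Fin 2 → R3 → ℂ} (hG : ∀ l, AEStronglyMeasurable (G l)) :
    AEStronglyMeasurable (fun p : Mode => G p.2 p.1) modeMeasure := by
  have h : (fun p : Mode => G p.2 p.1) =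
      fun p : Mode => ∑ l, (Prod.snd ⁻¹' {l}).indicator (fun p : Mode => G l p.1) p := by
    funext p
    rw [Finset.sum_eq_single p.2 (fun l _ hl => Set.indicator_of_notMem (by simpa using hl.symm) _)
      (by simp), Set.indicator_of_mem (by simp)]
  rw [h]
  exact Finset.aestronglyMeasurable_fun_sum _ fun l _ =>
    (hG l).comp_fst.indicator (measurable_snd (measurableSet_singleton l))

theorem lintegral_mode_sq {G : Fin 2 → R3 → ℂ} (hG : ∀ l, AEStronglyMeasurable (G l)) :
    ∫⁻ p, ‖G p.2 p.1‖ₑ ^ 2 ∂modeMeasure = ∑ l, ∫⁻ k, ‖G l k‖ₑ ^ 2 :=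
  lintegral_modeMeasure ((aestronglyMeasurable_mode hG).enorm.pow_const 2)

theorem memLp_mode {G : Fin 2 → R3 → ℂ} (hG : ∀ l, MemLp (G l) 2) :
    MemLp (fun p : Mode => G p.2 p.1) 2 modeMeasure := by
  rw [memLp_two_iff_lintegral, lintegral_mode_sq fun l => (hG l).1]
  exact ⟨aestronglyMeasurable_mode fun l => (hG l).1,
    ENNReal.sum_lt_top.2 fun l _ => (memLp_two_iff_lintegral.1 (hG l)).2⟩

theorem memLp_of_mode {ψ : Mode → ℂ} (hψ : MemLp ψ 2 modeMeasure) (l : Fin 2) :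
    MemLp (fun k => ψ (k, l)) 2 := by
  have h := memLp_two_iff_lintegral.1 hψ
  refine memLp_two_iff_lintegral.2
    ⟨h.1.comp_quasiMeasurePreserving (quasiMeasurePreserving_mode l), ?_⟩
  rw [lintegral_modeMeasure (h.1.enorm.pow_const 2)] at h
  exact ENNReal.sum_lt_top.1 h.2 l (Finset.mem_univ l)

end Modes

/-! ### The commutation relation and the field energy in Fock space -/

section Fock

variable {Ψ : FockSeq}

theorem IsFockVector.memLp (hΨ : IsFockVector Ψ) (n : ℕ) : MemLp (Ψ n) 2 (photonMeasure n) :=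
  memLp_two_iff_lintegral.2
    ⟨hΨ.measurable n, (ENNReal.le_tsum n).trans_lt hΨ.normSq_lt_top⟩

theorem IsFockVector.ae_memLp_snoc (hΨ : IsFockVector Ψ) (n : ℕ) :
    ∀ᵐ x ∂photonMeasure n,
      MemLp (fun p => Ψ (n + 1) (Fin.snoc (α := fun _ => Mode) x p)) 2 modeMeasure := by
  have h := memLp_two_iff_lintegral.1 (hΨ.memLp (n + 1))
  have hm := h.1.comp_measurePreserving (measurePreserving_snoc modeMeasure n)
  have hfin := h.2
  rw [photonMeasure, lintegral_snoc (h.1.enorm.pow_const 2)] at hfin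
  filter_upwards [hm.prodMk_left,
    ae_lt_top' (hm.enorm.pow_const 2).lintegral_prod_right' hfin.ne] with x h1 h2
  exact memLp_two_iff_lintegral.2 ⟨h1, h2⟩

/-- The polarization sum merges with the momentum integral wherever the slice of Ψ is square
integrable, that is, for almost every x. -/
theorem annihilate_ae_eq {G : Fin 2 → R3 → ℂ} (hG : ∀ l, MemLp (G l) 2) (hΨ : IsFockVector Ψ)
    (n : ℕ) :
    annihilate G Ψ n =ᵐ[photonMeasure n] fun x => (Real.sqrt (n + 1) : ℂ) *
      ∫ p, G p.2 p.1 * Ψ (n + 1) (Fin.snoc (α := fun _ => Mode) x p) ∂modeMeasure := by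
  filter_upwards [hΨ.ae_memLp_snoc n] with x hx
  rw [annihilate]
  exact congrArg _ (integral_modeMeasure ((memLp_mode hG).integrable_mul hx)).symm

theorem enorm_sqrt_succ_sq (n : ℕ) : ‖(Real.sqrt (n + 1) : ℂ)‖ₑ ^ 2 = n + 1 := by
  rw [← ofReal_norm, Complex.norm_real, ← ENNReal.ofReal_pow (norm_nonneg _), Real.norm_eq_abs,
    sq_abs, Real.sq_sqrt (by positivity)]
  exact_mod_cast ENNReal.ofReal_natCast (n + 1)

theorem normSq_annihilate (G : Fin 2 → R3 → ℂ) (Ψ : FockSeq) :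
    normSq (annihilate G Ψ) = ∑' n : ℕ, ((n : ℝ≥0∞) + 1) * ∫⁻ x, ‖∑ l, ∫ k : R3,
      G l k * Ψ (n + 1) (Fin.snoc (α := fun _ => Mode) x (k, l))‖ₑ ^ 2 ∂photonMeasure n := by
  refine tsum_congr fun n => ?_
  rw [← lintegral_const_mul' _ _ (by finiteness)]
  simp_rw [annihilate, enorm_mul, mul_pow, enorm_sqrt_succ_sq]

/-- The commutation relation `a(G) a*(G) = a*(G) a(G) + ‖G‖²`, as an identity of quadratic forms. -/
theorem normSq_create {G : Fin 2 → R3 → ℂ} (hG : ∀ l, MemLp (G l) 2) (hΨ : IsFockVector Ψ) :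
    normSq (create G Ψ) = (∑ l, ∫⁻ k, ‖G l k‖ₑ ^ 2) * normSq Ψ +
      normSq (annihilate (fun l k => conj (G l k)) Ψ) := by
  have hG' := memLp_mode hG
  have hterm (n : ℕ) (x : Fin (n + 1) → Mode) : ‖create G Ψ (n + 1) x‖ₑ ^ 2 =
      ((n : ℝ≥0∞) + 1)⁻¹ * ‖∑ i, tensorTerm (fun p : Mode => G p.2 p.1) (Ψ n) i x‖ₑ ^ 2 := by
    rw [create, enorm_mul, mul_pow, enorm_inv (by simp; positivity), ← ENNReal.inv_pow,
      enorm_sqrt_succ_sq]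
    rfl
  have h0 : ∫⁻ x, ‖create G Ψ 0 x‖ₑ ^ 2 ∂photonMeasure 0 = 0 := by simp [create]
  -- A photon created from the vacuum component has no partner to be exchanged with, so there are no
  -- cross terms here.
  have h1 : ∫⁻ x, ‖create G Ψ (0 + 1) x‖ₑ ^ 2 ∂photonMeasure (0 + 1) =
      (∑ l, ∫⁻ k, ‖G l k‖ₑ ^ 2) * ∫⁻ x, ‖Ψ 0 x‖ₑ ^ 2 ∂photonMeasure 0 := by
    simp_rw [hterm, ← lintegral_mode_sq fun l => (hG l).1]
    simpa [photonMeasure] using lintegral_tensorTerm hG'.1 (hΨ.measurable 0) 0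
  -- After division by n+2, the diagonal terms give ‖G‖²‖Ψ‖² and the cross terms n+1 times the
  -- contraction, which is the annihilation term two sectors below.
  have h2 (n : ℕ) : ∫⁻ x, ‖create G Ψ (n + 1 + 1) x‖ₑ ^ 2 ∂photonMeasure (n + 1 + 1) =
      (∑ l, ∫⁻ k, ‖G l k‖ₑ ^ 2) * ∫⁻ x, ‖Ψ (n + 1) x‖ₑ ^ 2 ∂photonMeasure (n + 1) +
      ∫⁻ x, ‖annihilate (fun l k => conj (G l k)) Ψ n x‖ₑ ^ 2 ∂photonMeasure n := by
    have ha : ∫⁻ x, ‖annihilate (fun l k => conj (G l k)) Ψ n x‖ₑ ^ 2 ∂photonMeasure n =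
        (n + 1) * ∫⁻ x, ‖∫ p, conj (G p.2 p.1) *
          Ψ (n + 1) (Fin.snoc (α := fun _ => Mode) x p) ∂modeMeasure‖ₑ ^ 2 ∂photonMeasure n := by
      rw [← lintegral_const_mul' _ _ (by finiteness)]
      refine lintegral_congr_ae ?_
      filter_upwards [annihilate_ae_eq (fun l => (hG l).star) hΨ n] with x hx
      change ‖annihilate (fun l => star (G l)) Ψ n x‖ₑ ^ 2 = _
      rw [hx, enorm_mul, mul_pow, enorm_sqrt_succ_sq]
      rfl
    have hn : ((n : ℝ≥0∞) + 2) ≠ ∞ := by finiteness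
    have hn0 : ((n : ℝ≥0∞) + 2) ≠ 0 := by simp
    have hcast : (((n + 1 : ℕ) : ℝ≥0∞) + 1) = n + 2 := by push_cast; ring
    simp_rw [hterm, ← lintegral_mode_sq fun l => (hG l).1]
    rw [hcast, lintegral_const_mul' _ _ (by simp), ha, photonMeasure,
      lintegral_sum_tensorTerm hG' (hΨ.memLp (n + 1)) (hΨ.symmetric (n + 1)), mul_add, mul_assoc,
      ← mul_assoc, ← mul_assoc _⁻¹, ENNReal.inv_mul_cancel hn0 hn, one_mul, one_mul]
    rfl
  rw [normSq, tsum_eq_zero_add' ENNReal.summable, h0, zero_add,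
    tsum_eq_zero_add' ENNReal.summable, h1]
  simp_rw [h2]
  rw [ENNReal.tsum_add, ENNReal.tsum_mul_left, ← add_assoc, ← mul_add]
  congr 2
  exact (tsum_eq_zero_add' (f := fun n => ∫⁻ x, ‖Ψ n x‖ₑ ^ 2 ∂photonMeasure n)
    ENNReal.summable).symm

/-- The field energy in terms of the annihilation operators. -/
theorem fieldEnergy_eq (hΨ : IsFockVector Ψ) :
    fieldEnergy Ψ = ∑' n : ℕ, ((n : ℝ≥0∞) + 1) * ∫⁻ x, (∑ l, ∫⁻ k : R3, ENNReal.ofReal ‖k‖ *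
      ‖Ψ (n + 1) (Fin.snoc (α := fun _ => Mode) x (k, l))‖ₑ ^ 2) ∂photonMeasure n := by
  rw [fieldEnergy, tsum_eq_zero_add' ENNReal.summable]
  simp only [Finset.univ_eq_empty, Finset.sum_empty, ENNReal.ofReal_zero, zero_mul,
    lintegral_zero, zero_add]
  refine tsum_congr fun n => ?_
  simp_rw [ENNReal.ofReal_sum_of_nonneg fun i _ => norm_nonneg _]
  have he : Measurable fun p : Mode => ENNReal.ofReal ‖p.1‖ := by fun_prop
  rw [photonMeasure, lintegral_sum_weight he ((hΨ.measurable (n + 1)).enorm.pow_const 2)]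
  · congr 1
    refine lintegral_congr_ae ?_
    filter_upwards [hΨ.ae_memLp_snoc n] with x hx
    exact lintegral_modeMeasure (he.aemeasurable.mul (hx.1.enorm.pow_const 2))
  · intro σ
    filter_upwards [hΨ.symmetric (n + 1) σ] with x hx
    rw [hx]

end Fock

end FieldEnergy

namespace FieldEnergy

open Filter Topology

/-! ### From one-particle bounds to bounds by the field energy -/

section Bounds

variable {Ψ : FockSeq}

/-- The smearing function `A_l(k) exp(i k·y)`. -/
noncomputable def planeWave (A : Fin 2 → R3 → ℂ) (y : R3) (l : Fin 2) (k : R3) : ℂ :=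
  A l k * Complex.exp (Complex.I * (inner ℝ k y : ℝ))

theorem memLp_planeWave {A : Fin 2 → R3 → ℂ} (hA : ∀ l, MemLp (A l) 2) (y : R3) (l : Fin 2) :
    MemLp (planeWave A y l) 2 := memLp_mul_planeWave (hA l) y

theorem lintegral_planeWave_enorm_sq (A : Fin 2 → R3 → ℂ) (y : R3) (l : Fin 2) :
    ∫⁻ k, ‖planeWave A y l k‖ₑ ^ 2 = ∫⁻ k, ‖A l k‖ₑ ^ 2 := by
  simp_rw [planeWave, enorm_mul, enorm_exp_I_mul, mul_one]

/-- The `n`-photon amplitude `∑_l ∫ A_l(k) e^{i k·y} Ψ_{n+1}(x, (k, l)) dk`. -/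
noncomputable def contraction (A : Fin 2 → R3 → ℂ) (Ψ : FockSeq) (n : ℕ) (y : R3) (x : Fin n → Mode) : ℂ :=
  ∑ l, ∫ k : R3, planeWave A y l k * Ψ (n + 1) (Fin.snoc (α := fun _ => Mode) x (k, l))

/-- Joint measurability in y and the frozen photons, needed for Tonelli. Since Ψ is only a.e.
measurable, the maps into configuration space must pull null sets back to null sets. -/
theorem aestronglyMeasurable_contraction {A : Fin 2 → R3 → ℂ}
    (hA : ∀ l, AEStronglyMeasurable (A l)) (hΨ : IsFockVector Ψ) (n : ℕ) :
    AEStronglyMeasurable (fun q : R3 × (Fin n → Mode) => contraction A Ψ n q.1 q.2)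
      (volume.prod (photonMeasure n)) := by
  refine Finset.aestronglyMeasurable_fun_sum _ fun l _ => ?_
  have h1 : Measure.QuasiMeasurePreserving
      (fun q : (Fin n → Mode) × R3 => (Fin.snoc (α := fun _ => Mode) q.1 (q.2, l)))
      ((photonMeasure n).prod volume) (photonMeasure (n + 1)) :=
    (measurePreserving_snoc modeMeasure n).quasiMeasurePreserving.comp
      (MeasureTheory.QuasiMeasurePreserving.prodMap (Measure.QuasiMeasurePreserving.id _)
        (quasiMeasurePreserving_mode l))
  have h2 : Measure.QuasiMeasurePreserving
      (fun q : (R3 × (Fin n → Mode)) × R3 => (q.1.2, q.2))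
      ((volume.prod (photonMeasure n)).prod volume) ((photonMeasure n).prod volume) :=
    MeasureTheory.QuasiMeasurePreserving.prodMap Measure.quasiMeasurePreserving_snd
      (Measure.QuasiMeasurePreserving.id _)
  have h3 : AEStronglyMeasurable (fun q : (R3 × (Fin n → Mode)) × R3 =>
      planeWave A q.1.1 l q.2 * Ψ (n + 1) (Fin.snoc (α := fun _ => Mode) q.1.2 (q.2, l)))
      ((volume.prod (photonMeasure n)).prod volume) := by
    refine AEStronglyMeasurable.mul ?_
      ((hΨ.measurable (n + 1)).comp_quasiMeasurePreserving (h1.comp h2))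
    refine (hA l).comp_snd.mul (Measurable.aestronglyMeasurable ?_)
    fun_prop
  exact h3.integral_prod_right'

theorem normSq_annihilate_planeWave (A : Fin 2 → R3 → ℂ) (Ψ : FockSeq) (y : R3) :
    normSq (annihilate (planeWave A y) Ψ) = ∑' n : ℕ, ((n : ℝ≥0∞) + 1) *
      ∫⁻ x, ‖contraction A Ψ n y x‖ₑ ^ 2 ∂photonMeasure n :=
  normSq_annihilate _ _

theorem aemeasurable_lintegral_contraction {A : Fin 2 → R3 → ℂ}
    (hA : ∀ l, AEStronglyMeasurable (A l)) (hΨ : IsFockVector Ψ) (n : ℕ) :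
    AEMeasurable fun y => ∫⁻ x, ‖contraction A Ψ n y x‖ₑ ^ 2 ∂photonMeasure n :=
  ((aestronglyMeasurable_contraction hA hΨ n).enorm.pow_const 2).lintegral_prod_right'

theorem aemeasurable_normSq_annihilate {A : Fin 2 → R3 → ℂ}
    (hA : ∀ l, AEStronglyMeasurable (A l)) (hΨ : IsFockVector Ψ) :
    AEMeasurable fun y => normSq (annihilate (planeWave A y) Ψ) := by
  simp_rw [normSq_annihilate_planeWave]
  exact AEMeasurable.tsum fun n =>
    (aemeasurable_lintegral_contraction hA hΨ n).const_mul _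

/-- A one-particle bound implies the corresponding bound by the field energy. -/
theorem tsum_lintegral_normSq_annihilate_le {J : Type*} [Countable J] {w : R3 → ℝ≥0∞}
    (hw : AEMeasurable w) {A : J → Fin 2 → R3 → ℂ} (hA : ∀ j l, MemLp (A j l) 2)
    (bound : ∀ ψ : Fin 2 → R3 → ℂ, (∀ l, MemLp (ψ l) 2) →
      ∑' j, ∫⁻ y, w y * ‖∑ l, ∫ k, planeWave (A j) y l k * ψ l k‖ₑ ^ 2 ≤
      ∑ l, ∫⁻ k, ENNReal.ofReal ‖k‖ * ‖ψ l k‖ₑ ^ 2) (hΨ : IsFockVector Ψ) :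
    ∑' j, ∫⁻ y, w y * normSq (annihilate (planeWave (A j) y) Ψ) ≤ fieldEnergy Ψ := by
  have hm (j : J) (n : ℕ) := aestronglyMeasurable_contraction (fun l => (hA j l).1) hΨ n
  have hm' (j : J) (n : ℕ) : AEMeasurable (fun q : R3 × (Fin n → Mode) =>
      w q.1 * ‖contraction (A j) Ψ n q.1 q.2‖ₑ ^ 2) (volume.prod (photonMeasure n)) :=
    (hw.comp_quasiMeasurePreserving Measure.quasiMeasurePreserving_fst).mul
      ((hm j n).enorm.pow_const 2)
  have e1 (j : J) : ∫⁻ y, w y * normSq (annihilate (planeWave (A j) y) Ψ) =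
      ∑' n : ℕ, ((n : ℝ≥0∞) + 1) *
        ∫⁻ x, (∫⁻ y, w y * ‖contraction (A j) Ψ n y x‖ₑ ^ 2) ∂photonMeasure n := by
    simp_rw [normSq_annihilate_planeWave, ← ENNReal.tsum_mul_left]
    refine (lintegral_tsum fun n => hw.mul ((aemeasurable_lintegral_contraction
      (fun l => (hA j l).1) hΨ n).const_mul _)).trans (tsum_congr fun n => ?_)
    simp only [Pi.mul_apply]
    rw [← lintegral_lintegral_swap (hm' j n), ← lintegral_const_mul' _ _ (by finiteness)]
    refine lintegral_congr_ae ?_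
    filter_upwards [(hm j n).prodMk_left] with y hy
    rw [lintegral_const_mul'' _ (hy.enorm.pow_const 2)]
    ring
  simp_rw [e1]
  rw [ENNReal.tsum_comm, fieldEnergy_eq hΨ]
  refine ENNReal.tsum_le_tsum fun n => ?_
  rw [ENNReal.tsum_mul_left]
  gcongr
  rw [← lintegral_tsum fun j => (hm' j n).lintegral_prod_left']
  refine lintegral_mono_ae ?_
  filter_upwards [hΨ.ae_memLp_snoc n] with x hx
  -- The one-particle bound, with the other n photons frozen at x.
  exact bound (fun l k => Ψ (n + 1) (Fin.snoc (α := fun _ => Mode) x (k, l))) fun l =>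
    memLp_of_mode hx l

theorem normSq_add_smul_le {X Y : FockSeq} (hX : ∀ n, AEStronglyMeasurable (X n) (photonMeasure n))
    {c : ℂ} (hc : ‖c‖ₑ = 1) : normSq (X + c • Y) ≤ 2 * normSq X + 2 * normSq Y := by
  simp_rw [normSq, ← ENNReal.tsum_mul_left, ← ENNReal.tsum_add]
  refine ENNReal.tsum_le_tsum fun n => ?_
  rw [← lintegral_const_mul' _ _ (by finiteness), ← lintegral_const_mul' _ _ (by finiteness),
    ← lintegral_add_left' (((hX n).enorm.pow_const 2).const_mul 2)]
  refine lintegral_mono fun x => ?_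
  have h : ‖(X + c • Y) n x‖ₑ ≤ ‖X n x‖ₑ + ‖Y n x‖ₑ := by
    refine (enorm_add_le _ _).trans_eq ?_
    change _ + ‖c * Y n x‖ₑ = _
    rw [enorm_mul, hc, one_mul]
  grw [h]
  have := ENNReal.rpow_add_le_mul_rpow_add_rpow ‖X n x‖ₑ ‖Y n x‖ₑ (p := 2) one_le_two
  rw [← mul_add]
  norm_num at this
  exact this

/-- The commutation relation trades 2‖a*Ψ‖² for 2‖aΨ‖² plus a multiple of ‖Ψ‖². Multiplied by 1/4,
the coefficients 4 and 2 become the 1 and 1/2 of the field bounds. -/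
theorem normSq_annihilate_add_create_le {G : Fin 2 → R3 → ℂ} (hG : ∀ l, MemLp (G l) 2)
    (hΨ : IsFockVector Ψ) {c : ℂ} (hc : ‖c‖ₑ = 1) :
    normSq (annihilate G Ψ + c • create (fun l k => conj (G l k)) Ψ) ≤
      4 * normSq (annihilate G Ψ) + 2 * ((∑ l, ∫⁻ k, ‖G l k‖ₑ ^ 2) * normSq Ψ) := by
  have hm (n : ℕ) : AEStronglyMeasurable (annihilate G Ψ n) (photonMeasure n) := by
    refine AEStronglyMeasurable.congr ?_ (annihilate_ae_eq hG hΨ n).symm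
    refine AEStronglyMeasurable.const_mul ?_ _
    exact ((memLp_mode hG).1.comp_snd.mul ((hΨ.measurable (n + 1)).comp_measurePreserving
      (measurePreserving_snoc modeMeasure n))).integral_prod_right'
  refine (normSq_add_smul_le hm hc).trans_eq ?_
  rw [normSq_create (G := fun l k => conj (G l k)) (fun l => (hG l).star) hΨ]
  simp only [Complex.conj_conj, RCLike.enorm_conj]
  ring

section

variable {J : Type*} [Countable J] {w : R3 → ℝ≥0∞} {A : J → Fin 2 → R3 → ℂ}

/-- A pointwise bound for the weighted form of the square of a field operator. -/
noncomputable def fieldSquareBound (w : R3 → ℝ≥0∞) (A : Fin 2 → R3 → ℂ) (Ψ : FockSeq) (y : R3) : ℝ≥0∞ :=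
  4 * (w y * normSq (annihilate (planeWave A y) Ψ)) +
    2 * ((∑ l, ∫⁻ k, ‖A l k‖ₑ ^ 2) * normSq Ψ) * w y

theorem mul_normSq_add_le_fieldSquareBound (w : R3 → ℝ≥0∞) {A : Fin 2 → R3 → ℂ}
    (hA : ∀ l, MemLp (A l) 2) (hΨ : IsFockVector Ψ) {c : ℂ} (hc : ‖c‖ₑ = 1) (y : R3) :
    w y * normSq (annihilate (planeWave A y) Ψ +
      c • create (fun l k => conj (planeWave A y l k)) Ψ) ≤ fieldSquareBound w A Ψ y := by
  grw [normSq_annihilate_add_create_le (memLp_planeWave hA y) hΨ hc]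
  simp_rw [lintegral_planeWave_enorm_sq]
  apply le_of_eq
  rw [fieldSquareBound]
  ring

theorem aemeasurable_fieldSquareBound (hw : AEMeasurable w) {A : Fin 2 → R3 → ℂ}
    (hA : ∀ l, AEStronglyMeasurable (A l)) (hΨ : IsFockVector Ψ) :
    AEMeasurable (fieldSquareBound w A Ψ) :=
  ((hw.mul (aemeasurable_normSq_annihilate hA hΨ)).const_mul 4).add (hw.const_mul _)

theorem tsum_lintegral_fieldSquareBound_le (hw : AEMeasurable w) (hA : ∀ j l, MemLp (A j l) 2)
    (bound : ∀ ψ : Fin 2 → R3 → ℂ, (∀ l, MemLp (ψ l) 2) →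
      ∑' j, ∫⁻ y, w y * ‖∑ l, ∫ k, planeWave (A j) y l k * ψ l k‖ₑ ^ 2 ≤
      ∑ l, ∫⁻ k, ENNReal.ofReal ‖k‖ * ‖ψ l k‖ₑ ^ 2) (hΨ : IsFockVector Ψ) :
    (1 / 4) * ∑' j, ∫⁻ y, fieldSquareBound w (A j) Ψ y ≤
      fieldEnergy Ψ + (1 / 2) * (∑' j, ∑ l, ∫⁻ k, ‖A j l k‖ₑ ^ 2) * (∫⁻ y, w y) * normSq Ψ := by
  have h4 : (1 / 4 : ℝ≥0∞) * 4 = 1 := by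
    rw [one_div]
    exact ENNReal.inv_mul_cancel (by simp) (by simp)
  have h2 : (1 / 4 : ℝ≥0∞) * 2 = 1 / 2 := by
    rw [← ENNReal.toReal_eq_toReal_iff' (by finiteness) (by finiteness)]
    simp
    norm_num
  have hint (j : J) : ∫⁻ y, fieldSquareBound w (A j) Ψ y =
      4 * (∫⁻ y, w y * normSq (annihilate (planeWave (A j) y) Ψ)) +
        2 * ((∑ l, ∫⁻ k, ‖A j l k‖ₑ ^ 2) * (∫⁻ y, w y) * normSq Ψ) := by
    have hm : AEMeasurable fun y => 4 * (w y * normSq (annihilate (planeWave (A j) y) Ψ)) :=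
      (hw.mul (aemeasurable_normSq_annihilate (fun l => (hA j l).1) hΨ)).const_mul 4
    simp_rw [fieldSquareBound]
    rw [lintegral_add_left' hm, lintegral_const_mul'' _ hw,
      lintegral_const_mul' _ _ (by finiteness)]
    ring
  simp_rw [hint]
  rw [ENNReal.tsum_add, ENNReal.tsum_mul_left, ENNReal.tsum_mul_left, ENNReal.tsum_mul_right,
    ENNReal.tsum_mul_right, mul_add, ← mul_assoc, h4, one_mul, ← mul_assoc (1 / 4), h2]
  grw [tsum_lintegral_normSq_annihilate_le hw hA bound hΨ]
  apply le_of_eq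
  ring

end

end Bounds

end FieldEnergy

namespace FieldEnergy

open Filter Topology

/-! ### The fields L_j and convergence of their weighted forms -/

section WeightedFields

variable {Λ : ℝ} {J : Set ℤ} {v : Fin 2 → J → 𝓢'(R3, ℂ)} {vhat : Fin 2 → J → R3 → ℂ} {w : R3 → ℝ}

/-- Pairing with a bump function equal to 1 on the ball shows that `vhat` agrees there with an
integrable function. -/
theorem IsFourierTransformOf.aestronglyMeasurable {vhat : R3 → ℂ} {v : 𝓢'(R3, ℂ)}
    (h : IsFourierTransformOf vhat v) (hΛ : 0 < Λ) :
    AEStronglyMeasurable vhat (volume.restrict (Metric.ball 0 Λ)) := by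
  let b : ContDiffBump (0 : R3) := ⟨Λ, Λ + 1, hΛ, by linarith⟩
  have hb : HasCompactSupport fun k => ((b k : ℝ) : ℂ) :=
    b.hasCompactSupport.comp_left Complex.ofReal_zero
  have hbs : ContDiff ℝ ((⊤ : ℕ∞) : WithTop ℕ∞) fun k => ((b k : ℝ) : ℂ) :=
    Complex.ofRealCLM.contDiff.comp b.contDiff
  refine (h (hb.toSchwartzMap hbs)).1.1.restrict.congr ?_
  filter_upwards [ae_restrict_mem measurableSet_ball] with k hk
  simp [b.one_of_mem_closedBall (Metric.ball_subset_closedBall hk)]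

/-- The coefficient `1_{|k| < Λ} √|k| vhat_λ(k)`. -/
noncomputable def modeCoeff (Λ : ℝ) (vhat : R3 → ℂ) (k : R3) : ℂ :=
  (Metric.ball (0 : R3) Λ).indicator (fun k => (Real.sqrt ‖k‖ : ℂ) * vhat k) k

theorem modeFunction_eq_planeWave (Λ : ℝ) (vhat : Fin 2 → R3 → ℂ) (y : R3) :
    modeFunction Λ vhat y = planeWave (fun l => modeCoeff Λ (vhat l)) y := by
  funext l k
  classical
  simp only [modeFunction, planeWave, modeCoeff, Set.indicator_apply]
  split_ifs <;> simp

theorem lintegral_modeCoeff_sq (Λ : ℝ) (vhat : R3 → ℂ) :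
    ∫⁻ k, ‖modeCoeff Λ vhat k‖ₑ ^ 2 =
      ∫⁻ k in Metric.ball (0 : R3) Λ, ENNReal.ofReal ‖k‖ * ‖vhat k‖ₑ ^ 2 := by
  rw [← lintegral_indicator measurableSet_ball]
  refine lintegral_congr fun k => ?_
  classical
  simp only [modeCoeff, Set.indicator_apply, ofReal_norm_mul_enorm_sq]
  split_ifs <;> simp

theorem memLp_modeCoeff (hΛ : 0 < Λ) {vhat : R3 → ℂ} {v : 𝓢'(R3, ℂ)}
    (h : IsFourierTransformOf vhat v)
    (hfin : ∫⁻ k in Metric.ball (0 : R3) Λ, ENNReal.ofReal ‖k‖ * ‖vhat k‖ₑ ^ 2 < ∞) :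
    MemLp (modeCoeff Λ vhat) 2 := by
  rw [memLp_two_iff_lintegral, lintegral_modeCoeff_sq]
  refine ⟨?_, hfin⟩
  refine (aestronglyMeasurable_indicator_iff measurableSet_ball).2 ?_
  exact (by fun_prop : Continuous fun k : R3 => (Real.sqrt ‖k‖ : ℂ)).aestronglyMeasurable.mul
    (h.aestronglyMeasurable hΛ)

theorem modeCoeff_bound (hΛ : 0 < Λ) (hv : ∀ l j, IsFourierTransformOf (vhat l j) (v l j))
    (hfin : ∀ l j, ∫⁻ k in Metric.ball (0 : R3) Λ, ENNReal.ofReal ‖k‖ * ‖vhat l j k‖ₑ ^ 2 < ∞)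
    (hw : Integrable w) (h : weightNorm v w ≤ 1) (ψ : Fin 2 → R3 → ℂ) (hψ : ∀ l, MemLp (ψ l) 2) :
    ∑' j : J, ∫⁻ y, ‖w y‖ₑ *
        ‖∑ l, ∫ k, planeWave (fun l => modeCoeff Λ (vhat l j)) y l k * ψ l k‖ₑ ^ 2 ≤
      ∑ l, ∫⁻ k, ENNReal.ofReal ‖k‖ * ‖ψ l k‖ₑ ^ 2 := by
  have hA (l : Fin 2) (j : J) : MemLp (fun k => (Real.sqrt ‖k‖ : ℂ) * vhat l j k) 2
      (volume.restrict (Metric.ball 0 Λ)) :=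
    (memLp_indicator_iff_restrict measurableSet_ball).1 (memLp_modeCoeff hΛ (hv l j) (hfin l j))
  refine (le_of_eq ?_).trans ((tsum_lintegral_planeWave_le_of_weightNorm hv hw h hA
    fun l => (hψ l).restrict _).trans (Finset.sum_le_sum fun l _ => setLIntegral_le_lintegral _ _))
  refine tsum_congr fun j => lintegral_congr fun y => ?_
  rw [mul_comm]
  congr 3
  refine Finset.sum_congr rfl fun l _ => ?_
  rw [← integral_indicator measurableSet_ball]
  refine integral_congr_ae (Eventually.of_forall fun k => ?_)
  classical
  simp only [planeWave, modeCoeff, Set.indicator_apply]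
  split_ifs <;> simp

/-- `toReal` sends ∞ to 0; the first conclusion ensures that this default occurs only on a null set
or where w vanishes. -/
theorem absolutely_convergent_of_tsum_le {J : Type*} {w : R3 → ℝ} (hw : AEStronglyMeasurable w)
    {N : J → R3 → ℝ≥0∞} (hN : ∀ j, AEMeasurable (N j)) {E : ℝ≥0∞} (hE : E < ∞)
    (h : ∑' j, ∫⁻ y, ‖w y‖ₑ * N j y ≤ E) :
    (∀ j, ∀ᵐ y, w y ≠ 0 → N j y < ∞) ∧ (∀ j, Integrable fun y => w y * (N j y).toReal) ∧
      (Summable fun j => ∫ y, w y * (N j y).toReal) ∧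
      ∑' j, ∫ y, w y * (N j y).toReal ≤ E.toReal := by
  have hsum := (h.trans_lt hE).ne
  have hj (j : J) : ∫⁻ y, ‖w y‖ₑ * N j y < ∞ := (ENNReal.ne_top_of_tsum_ne_top hsum j).lt_top
  have hle (j : J) (y : R3) : ‖w y * (N j y).toReal‖ₑ ≤ ‖w y‖ₑ * N j y := by
    rw [enorm_mul, Real.enorm_of_nonneg ENNReal.toReal_nonneg]
    gcongr
    exact ENNReal.ofReal_toReal_le
  have hnorm (j : J) : ‖∫ y, w y * (N j y).toReal‖ ≤ (∫⁻ y, ‖w y‖ₑ * N j y).toReal := by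
    rw [← toReal_enorm]
    exact ENNReal.toReal_mono (hj j).ne
      ((enorm_integral_le_lintegral_enorm _).trans (lintegral_mono (hle j)))
  have hs := ENNReal.summable_toReal hsum
  refine ⟨fun j => ?_, fun j => ⟨hw.mul (hN j).ennreal_toReal.aestronglyMeasurable,
    (lintegral_mono (hle j)).trans_lt (hj j)⟩, Summable.of_norm_bounded hs hnorm, ?_⟩
  · filter_upwards [ae_lt_top' (hw.enorm.mul (hN j)) (hj j).ne] with y hy hwy
    exact ENNReal.lt_top_of_mul_ne_top_right hy.ne (by simpa using hwy)
  · calc _ ≤ ∑' j, (∫⁻ y, ‖w y‖ₑ * N j y).toReal :=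
          (Summable.of_norm_bounded hs hnorm).tsum_le_tsum (fun j => (le_abs_self _).trans (hnorm j)) hs
      _ = (∑' j, ∫⁻ y, ‖w y‖ₑ * N j y).toReal := (ENNReal.tsum_toReal_eq fun j => (hj j).ne).symm
      _ ≤ _ := ENNReal.toReal_mono hE.ne h

end WeightedFields

/-! ### Coefficients of the magnetic field -/

section Magnetic

theorem lintegral_closedBall_norm {Λ : ℝ} (hΛ : 0 < Λ) :
    ∫⁻ k in Metric.closedBall (0 : R3) Λ, ENNReal.ofReal ‖k‖ = ENNReal.ofReal (Real.pi * Λ ^ 4) := by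
  have hint : IntegrableOn (fun k : R3 => ‖k‖) (Metric.closedBall 0 Λ) :=
    continuous_norm.continuousOn.integrableOn_compact (isCompact_closedBall 0 Λ)
  rw [← ofReal_integral_eq_lintegral_ofReal hint (Eventually.of_forall fun k => norm_nonneg k),
    ← integral_indicator Metric.isClosed_closedBall.measurableSet]
  congr 1
  have e : (Metric.closedBall (0 : R3) Λ).indicator (fun k => ‖k‖) =
      fun k => (Set.Iic Λ).indicator id ‖k‖ := by
    funext k
    classical
    simp [Set.indicator_apply]
  -- Polar coordinates: the sphere has area 3 · 4π/3 = 4π, and the radial integral of r³ is Λ⁴/4.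
  rw [e, integral_fun_norm_addHaar volume ((Set.Iic Λ).indicator id)]
  have h2 : ∫ y in Set.Ioi (0 : ℝ), y ^ (Module.finrank ℝ R3 - 1) • (Set.Iic Λ).indicator id y =
      Λ ^ 4 / 4 := by
    have : (fun y : ℝ => y ^ (Module.finrank ℝ R3 - 1) • (Set.Iic Λ).indicator id y) =
        (Set.Iic Λ).indicator fun y => y ^ 3 := by
      funext y
      classical
      simp only [Set.indicator_apply, finrank_euclideanSpace, Fintype.card_fin]
      split_ifs
      · simp; ring
      · simp
    rw [this, setIntegral_indicator measurableSet_Iic, Set.Ioi_inter_Iic,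
      ← intervalIntegral.integral_of_le hΛ.le, integral_pow]
    norm_num
  rw [h2]
  rw [Measure.real, EuclideanSpace.volume_ball_fin_three, ENNReal.ofReal_one, one_pow, one_mul,
    ENNReal.toReal_ofReal (by positivity)]
  simp
  ring

theorem sum_norm_sq_of_orthogonal {u v : Fin 3 → ℝ} {r : ℝ} (hu : u ⬝ᵥ u = r) (hv : v ⬝ᵥ v = r)
    (huv : u ⬝ᵥ v = 0) (a b : ℂ) :
    ∑ j, ‖(u j : ℂ) * a + (v j : ℂ) * b‖ ^ 2 = r * (‖a‖ ^ 2 + ‖b‖ ^ 2) := by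
  simp only [dotProduct, Fin.sum_univ_three] at hu hv huv
  simp only [Fin.sum_univ_three, Complex.sq_norm, Complex.normSq_apply, Complex.add_re,
    Complex.add_im, Complex.re_ofReal_mul, Complex.im_ofReal_mul]
  linear_combination (a.re ^ 2 + a.im ^ 2) * hu + (b.re ^ 2 + b.im ^ 2) * hv +
    2 * (a.re * b.re + a.im * b.im) * huv

/-- The coefficient `1_{|k| ≤ Λ} (k ∧ ε_λ(k))_j / √|k|`. -/
noncomputable def magneticCoeff (Λ : ℝ) (ε : Fin 2 → R3 → R3) (j : Fin 3) (l : Fin 2) (k : R3) : ℂ :=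
  (Metric.closedBall (0 : R3) Λ).indicator
    (fun k => ((crossProduct k.ofLp (ε l k).ofLp j / Real.sqrt ‖k‖ : ℝ) : ℂ)) k

variable {Λ : ℝ} {ε : Fin 2 → R3 → R3}

theorem magneticMode_eq_planeWave (Λ : ℝ) (ε : Fin 2 → R3 → R3) (j : Fin 3) (x : R3) :
    magneticMode Λ ε j x = planeWave (magneticCoeff Λ ε j) x := by
  funext l k
  classical
  simp only [magneticMode, planeWave, magneticCoeff, Set.indicator_apply]
  split_ifs <;> simp

/-- The coefficients are real, so x ↦ -x is complex conjugation; the creation part of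
`magneticField` is thus the formal adjoint of its annihilation part. -/
theorem magneticMode_neg (Λ : ℝ) (ε : Fin 2 → R3 → R3) (j : Fin 3) (x : R3) :
    magneticMode Λ ε j (-x) = fun l k => conj (planeWave (magneticCoeff Λ ε j) x l k) := by
  funext l k
  classical
  simp only [magneticMode, planeWave, magneticCoeff, Set.indicator_apply]
  split_ifs
  · simp [← Complex.exp_conj]
  · simp

theorem dotProduct_crossProduct_polarization (hε : IsPolarization ε) {k : R3} (hk : k ≠ 0)
    (l m : Fin 2) :
    crossProduct k.ofLp (ε l k).ofLp ⬝ᵥ crossProduct k.ofLp (ε m k).ofLp =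
      ‖k‖ ^ 2 * (if l = m then 1 else 0) := by
  have h1 (a b : R3) : a.ofLp ⬝ᵥ b.ofLp = inner ℝ a b := by
    simp [PiLp.inner_apply, dotProduct, mul_comm]
  rw [cross_dot_cross, h1, h1, h1, h1, hε.perp m k hk, real_inner_self_eq_norm_sq,
    orthonormal_iff_ite.1 (hε.orthonormal k hk) l m]
  ring

/-- For k ≠ 0 the vectors k ∧ ε_λ(k)/√|k| are orthogonal of length √|k|. At k = 0 both sides vanish.
-/
theorem sum_enorm_sq_magneticCoeff (hε : IsPolarization ε) (c : Fin 2 → ℂ) (k : R3) :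
    ∑ j, ‖∑ l, magneticCoeff Λ ε j l k * c l‖ₑ ^ 2 =
      (Metric.closedBall (0 : R3) Λ).indicator
        (fun k => ENNReal.ofReal ‖k‖ * ∑ l, ‖c l‖ₑ ^ 2) k := by
  classical
  simp only [magneticCoeff, Set.indicator_apply]
  split_ifs
  swap
  · simp
  rcases eq_or_ne k 0 with rfl | hk
  · simp
  have hk' : 0 < ‖k‖ := norm_pos_iff.2 hk
  let u (l : Fin 2) (j : Fin 3) : ℝ := crossProduct k.ofLp (ε l k).ofLp j / Real.sqrt ‖k‖
  have hu (l m : Fin 2) : u l ⬝ᵥ u m = ‖k‖ * (if l = m then 1 else 0) := by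
    have e (l : Fin 2) : u l = (Real.sqrt ‖k‖)⁻¹ • crossProduct k.ofLp (ε l k).ofLp := by
      funext j
      simp [u, div_eq_inv_mul]
    rw [e, e, smul_dotProduct, dotProduct_smul, dotProduct_crossProduct_polarization hε hk,
      smul_smul, ← mul_inv, Real.mul_self_sqrt hk'.le, smul_eq_mul]
    field_simp
  have h := sum_norm_sq_of_orthogonal (r := ‖k‖) (by simpa using hu 0 0) (by simpa using hu 1 1)
    (by simpa using hu 0 1) (c 0) (c 1)
  simp_rw [← ofReal_norm, ← ENNReal.ofReal_pow (norm_nonneg _), Fin.sum_univ_two]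
  rw [← ENNReal.ofReal_add (by positivity) (by positivity), ← ENNReal.ofReal_mul hk'.le, ← h,
    ENNReal.ofReal_sum_of_nonneg fun j _ => by positivity]

end Magnetic

end FieldEnergy

namespace FieldEnergy

open Filter Topology

/-! ### The magnetic field bound -/

section MagneticField

variable {Λ : ℝ} {ε : Fin 2 → R3 → R3}

theorem measurable_magneticCoeff (hε : IsPolarization ε) (j : Fin 3) (l : Fin 2) :
    Measurable (magneticCoeff Λ ε j l) := by
  have h (i : Fin 3) : Measurable fun k => (ε l k).ofLp i :=
    (EuclideanSpace.proj (𝕜 := ℝ) i).continuous.measurable.comp (hε.measurable l)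
  have h' (i : Fin 3) : Measurable fun k : R3 => k.ofLp i :=
    (EuclideanSpace.proj (𝕜 := ℝ) i).continuous.measurable
  refine Measurable.indicator ?_ Metric.isClosed_closedBall.measurableSet
  have hc : Measurable fun k : R3 => crossProduct k.ofLp (ε l k).ofLp j := by
    simp only [cross_apply]
    fin_cases j
    · exact ((h' 1).mul (h 2)).sub ((h' 2).mul (h 1))
    · exact ((h' 2).mul (h 0)).sub ((h' 0).mul (h 2))
    · exact ((h' 0).mul (h 1)).sub ((h' 1).mul (h 0))
  fun_prop

theorem sum_enorm_sq_magneticCoeff_single (hε : IsPolarization ε) (l : Fin 2) (k : R3) :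
    ∑ j, ‖magneticCoeff Λ ε j l k‖ₑ ^ 2 =
      (Metric.closedBall (0 : R3) Λ).indicator (fun k => ENNReal.ofReal ‖k‖) k := by
  have h := sum_enorm_sq_magneticCoeff (Λ := Λ) hε (Pi.single l 1) k
  have h1 : ∑ m, ‖(Pi.single l 1 : Fin 2 → ℂ) m‖ₑ ^ 2 = 1 := by
    rw [Finset.sum_eq_single l (fun m _ hm => by simp [hm]) (by simp)]
    simp
  rw [h1] at h
  simpa [Pi.single_apply] using h

theorem sum_lintegral_magneticCoeff (hε : IsPolarization ε) (hΛ : 0 < Λ) :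
    ∑ j, ∑ l, ∫⁻ k, ‖magneticCoeff Λ ε j l k‖ₑ ^ 2 = ENNReal.ofReal (2 * (Real.pi * Λ ^ 4)) := by
  rw [Finset.sum_comm]
  have h (l : Fin 2) : ∑ j, ∫⁻ k, ‖magneticCoeff Λ ε j l k‖ₑ ^ 2 =
      ENNReal.ofReal (Real.pi * Λ ^ 4) := by
    rw [← lintegral_finsetSum _ fun j _ => (measurable_magneticCoeff hε j l).enorm.pow_const 2]
    simp_rw [sum_enorm_sq_magneticCoeff_single hε]
    rw [lintegral_indicator Metric.isClosed_closedBall.measurableSet, lintegral_closedBall_norm hΛ]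
  simp_rw [h]
  rw [Finset.sum_const, ENNReal.ofReal_mul zero_le_two]
  simp

theorem memLp_magneticCoeff (hε : IsPolarization ε) (hΛ : 0 < Λ) (j : Fin 3) (l : Fin 2) :
    MemLp (magneticCoeff Λ ε j l) 2 := by
  refine memLp_two_iff_lintegral.2 ⟨(measurable_magneticCoeff hε j l).aestronglyMeasurable, ?_⟩
  have h := (sum_lintegral_magneticCoeff hε hΛ).trans_lt ENNReal.ofReal_lt_top
  exact ENNReal.sum_lt_top.1 (ENNReal.sum_lt_top.1 h j (Finset.mem_univ j)) l (Finset.mem_univ l)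

/-- The bound `∑_j ‖∑_λ ∫ A_{j,λ}(k) e^{i k·y} ψ_λ(k) dk‖² ≤ (2π)³ ∑_λ ∫ |k| |ψ_λ(k)|² dk`. -/
theorem magneticCoeff_bound (hε : IsPolarization ε) (hΛ : 0 < Λ) {w : R3 → ℝ≥0∞}
    (hw : ∀ y, w y ≤ ENNReal.ofReal ((2 * Real.pi) ^ 3)⁻¹) (ψ : Fin 2 → R3 → ℂ)
    (hψ : ∀ l, MemLp (ψ l) 2) :
    ∑' j, ∫⁻ y, w y * ‖∑ l, ∫ k, planeWave (magneticCoeff Λ ε j) y l k * ψ l k‖ₑ ^ 2 ≤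
      ∑ l, ∫⁻ k, ENNReal.ofReal ‖k‖ * ‖ψ l k‖ₑ ^ 2 := by
  have hpi : (0 : ℝ) < (2 * Real.pi) ^ 3 := by positivity
  -- Summing over polarizations first leaves one function per component. Plancherel gives its
  -- plane-wave integral the squared norm (2π)³‖h_j‖², and the bound on w cancels (2π)³.
  let h (j : Fin 3) (k : R3) : ℂ := ∑ l, magneticCoeff Λ ε j l k * ψ l k
  have hA := memLp_magneticCoeff hε hΛ
  have h1 (j : Fin 3) : Integrable (h j) :=
    integrable_finsetSum _ fun l _ => (hA j l).integrable_mul (hψ l)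
  have hsum : ∑ j, ∫⁻ k, ‖h j k‖ₑ ^ 2 =
      ∫⁻ k in Metric.closedBall 0 Λ, ENNReal.ofReal ‖k‖ * ∑ l, ‖ψ l k‖ₑ ^ 2 := by
    rw [← lintegral_finsetSum' _ fun j _ => (h1 j).1.enorm.pow_const 2,
      ← lintegral_indicator Metric.isClosed_closedBall.measurableSet]
    exact lintegral_congr fun k => sum_enorm_sq_magneticCoeff hε (fun l => ψ l k) k
  have hψ2 := ENNReal.sum_lt_top.2 fun l (_ : l ∈ Finset.univ) => (memLp_two_iff_lintegral.1 (hψ l)).2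
  rw [← lintegral_finsetSum' _ fun l _ => (hψ l).1.enorm.pow_const 2] at hψ2
  have hfin : ∑ j, ∫⁻ k, ‖h j k‖ₑ ^ 2 < ∞ := by
    rw [hsum]
    refine lt_of_le_of_lt ?_ (ENNReal.mul_lt_top (ENNReal.ofReal_lt_top (r := Λ)) hψ2)
    rw [← lintegral_const_mul' _ _ ENNReal.ofReal_ne_top]
    refine le_trans ?_ (setLIntegral_le_lintegral (Metric.closedBall 0 Λ) _)
    refine setLIntegral_mono' Metric.isClosed_closedBall.measurableSet fun k hk => ?_
    gcongr
    exact mem_closedBall_zero_iff.1 hk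
  have h2 (j : Fin 3) : MemLp (h j) 2 :=
    memLp_two_iff_lintegral.2 ⟨(h1 j).1, ENNReal.sum_lt_top.1 hfin j (Finset.mem_univ j)⟩
  have hplane (j : Fin 3) (y : R3) : ∑ l, ∫ k, planeWave (magneticCoeff Λ ε j) y l k * ψ l k =
      ∫ k, h j k * Complex.exp (Complex.I * (inner ℝ k y : ℝ)) := by
    refine (integral_finsetSum _ fun l _ =>
      (memLp_planeWave (hA j) y l).integrable_mul (hψ l)).symm.trans ?_
    refine integral_congr_ae (Eventually.of_forall fun k => ?_)
    simp only [h, planeWave, Finset.sum_mul, Pi.mul_apply]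
    exact Finset.sum_congr rfl fun l _ => by ring
  have hj (j : Fin 3) : ∫⁻ y, w y *
      ‖∑ l, ∫ k, planeWave (magneticCoeff Λ ε j) y l k * ψ l k‖ₑ ^ 2 ≤ ∫⁻ k, ‖h j k‖ₑ ^ 2 := by
    simp_rw [hplane]
    calc _ ≤ ∫⁻ y, ENNReal.ofReal ((2 * Real.pi) ^ 3)⁻¹ *
          ‖∫ k, h j k * Complex.exp (Complex.I * (inner ℝ k y : ℝ))‖ₑ ^ 2 := by
          gcongr with y
          exact hw y
      _ = _ := by
          rw [lintegral_const_mul' _ _ ENNReal.ofReal_ne_top, lintegral_planeWave_sq (h1 j) (h2 j),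
            ← mul_assoc, ← ENNReal.ofReal_mul (by positivity), inv_mul_cancel₀ hpi.ne',
            ENNReal.ofReal_one, one_mul]
  rw [tsum_fintype]
  refine (Finset.sum_le_sum fun j _ => hj j).trans ?_
  rw [hsum, ← lintegral_finsetSum' _ fun l _ => ?_]
  · simp_rw [Finset.mul_sum]
    exact setLIntegral_le_lintegral _ _
  · exact (by fun_prop : Measurable fun k : R3 => ENNReal.ofReal ‖k‖).aemeasurable.mul
      ((hψ l).1.enorm.pow_const 2)

theorem normSq_smul (c : ℂ) (X : FockSeq) : normSq (c • X) = ‖c‖ₑ ^ 2 * normSq X := by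
  rw [normSq, normSq, ← ENNReal.tsum_mul_left]
  refine tsum_congr fun n => ?_
  rw [← lintegral_const_mul' _ _ (by finiteness)]
  refine lintegral_congr fun x => ?_
  rw [← mul_pow, ← enorm_mul]
  rfl

theorem normSq_magneticField (Λ : ℝ) (ε : Fin 2 → R3 → R3) (j : Fin 3) (x : R3) (Ψ : FockSeq) :
    normSq (magneticField Λ ε j x Ψ) = ENNReal.ofReal (1 / (4 * Real.pi ^ 2)) *
      normSq (annihilate (planeWave (magneticCoeff Λ ε j) x) Ψ + (-1 : ℂ) •
        create (fun l k => conj (planeWave (magneticCoeff Λ ε j) x l k)) Ψ) := by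
  have hc : ‖(Complex.I / (2 * Real.pi) : ℂ)‖ₑ ^ 2 = ENNReal.ofReal (1 / (4 * Real.pi ^ 2)) := by
    rw [← ofReal_norm, ← ENNReal.ofReal_pow (norm_nonneg _)]
    congr 1
    simp only [norm_div, Complex.norm_I, norm_mul, Complex.norm_real, Real.norm_eq_abs,
      abs_of_pos Real.pi_pos, Complex.norm_ofNat]
    ring
  rw [magneticField, normSq_smul, hc, magneticMode_eq_planeWave, magneticMode_neg, neg_one_smul,
    sub_eq_add_neg]

theorem magneticField_bound (hΛ : 0 < Λ) (hε : IsPolarization ε) {w : R3 → ℝ} (hw : Integrable w)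
    (hw1 : ∀ y, w y ≤ 1) {Ψ : FockSeq} (hΨ : IsFockVector Ψ) :
    ENNReal.ofReal (1 / (8 * Real.pi)) * ∫⁻ x, ENNReal.ofReal (w x) *
        ∑ j, normSq (magneticField Λ ε j x Ψ) ≤
      fieldEnergy Ψ + ENNReal.ofReal (Λ ^ 4 / (8 * Real.pi ^ 2)) *
        (∫⁻ y, ENNReal.ofReal (w y)) * normSq Ψ := by
  have hpi := Real.pi_pos
  set κ := ENNReal.ofReal ((2 * Real.pi) ^ 3)⁻¹ with hκ
  let w' (y : R3) : ℝ≥0∞ := κ * ENNReal.ofReal (w y)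
  have hw' : AEMeasurable w' := hw.1.aemeasurable.ennreal_ofReal.const_mul κ
  have hw'1 (y : R3) : w' y ≤ κ := by
    calc w' y ≤ κ * 1 := by
          simp only [w']
          gcongr
          exact ENNReal.ofReal_le_one.2 (hw1 y)
      _ = κ := mul_one κ
  have hA := memLp_magneticCoeff hε hΛ
  have key := tsum_lintegral_fieldSquareBound_le hw' hA (magneticCoeff_bound hε hΛ hw'1) hΨ
  rw [tsum_fintype, tsum_fintype, sum_lintegral_magneticCoeff hε hΛ,
    lintegral_const_mul' κ _ ENNReal.ofReal_ne_top] at key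
  have e4 : (1 / 4 : ℝ≥0∞) = ENNReal.ofReal (1 / 4) := by
    rw [ENNReal.ofReal_div_of_pos (by norm_num)]
    simp
  have e2 : (1 / 2 : ℝ≥0∞) = ENNReal.ofReal (1 / 2) := by
    rw [ENNReal.ofReal_div_of_pos (by norm_num)]
    simp
  -- 1/(4π²) is the squared modulus of the prefactor i/(2π), and 1/(32π³) = (1/4)(2π)⁻³.
  have econst : ENNReal.ofReal (1 / (8 * Real.pi)) * ENNReal.ofReal (1 / (4 * Real.pi ^ 2)) =
      ENNReal.ofReal (1 / 4) * κ := by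
    rw [hκ, ← ENNReal.ofReal_mul (by positivity), ← ENNReal.ofReal_mul (by positivity)]
    congr 1
    field_simp
    norm_num
  refine le_trans ?_ (key.trans (le_of_eq ?_))
  -- The sum and the integral are exchanged for the majorant `fieldSquareBound`, whose measurability
  -- in x is known.
  · rw [← lintegral_finsetSum' _ fun j _ =>
      aemeasurable_fieldSquareBound hw' (fun l => (hA j l).1) hΨ]
    calc _ = ENNReal.ofReal (1 / 4) * ∫⁻ x, ∑ j, w' x *
          normSq (annihilate (planeWave (magneticCoeff Λ ε j) x) Ψ + (-1 : ℂ) •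
            create (fun l k => conj (planeWave (magneticCoeff Λ ε j) x l k)) Ψ) := by
          rw [← lintegral_const_mul' _ _ ENNReal.ofReal_ne_top,
            ← lintegral_const_mul' _ _ ENNReal.ofReal_ne_top]
          refine lintegral_congr fun x => ?_
          simp_rw [normSq_magneticField, ← Finset.mul_sum, w', ← mul_assoc]
          congr 1
          rw [mul_right_comm, econst]
      _ ≤ _ := by
          rw [e4]
          gcongr with x j
          exact mul_normSq_add_le_fieldSquareBound w' (hA j) hΨ (by simp) x
  -- The constant is (1/2) · 2πΛ⁴ · (2π)⁻³ = Λ⁴/(8π²).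
  · congr 2
    rw [e2, ← mul_assoc, ← ENNReal.ofReal_mul (by positivity), hκ,
      ← ENNReal.ofReal_mul (by positivity)]
    congr 2
    field_simp
    norm_num

end MagneticField

end FieldEnergy

/-- Operator inequalities are inequalities of quadratic forms. For a symmetric operator `X` the form
of `X²` is `‖X Ψ‖²`, so the form of `L* L` is `‖L Ψ‖²`, and, as `L + s L*` is symmetric for `s = 1`
and antisymmetric for `s = -1`, the form of `s (L + s L*)²` is `‖(L + s L*) Ψ‖²` in both cases.
The subtracted constants are added to the other side, in `[0, ∞]`. -/
theorem mainTheorem6 (Λ : ℝ) (hΛ : 0 < Λ) :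
    (∀ (J : Set ℤ) (v : Fin 2 → J → 𝓢'(FieldEnergy.R3, ℂ))
      (vhat : Fin 2 → J → FieldEnergy.R3 → ℂ) (w : FieldEnergy.R3 → ℝ),
      (∀ l j, FieldEnergy.IsFourierTransformOf (vhat l j) (v l j)) →
      (∀ l j, ∫⁻ k in Metric.ball (0 : FieldEnergy.R3) Λ,
        ENNReal.ofReal ‖k‖ * ‖vhat l j k‖ₑ ^ 2 < ∞) →
      Integrable w →
      FieldEnergy.weightNorm v w ≤ 1 →
      -- `H_f ≥ ∑_j ∫ w L_j* L_j`
      (∀ Ψ : FieldEnergy.FockSeq, FieldEnergy.IsFockVector Ψ → FieldEnergy.fieldEnergy Ψ < ∞ →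
        (∀ j, ∀ᵐ y, w y ≠ 0 →
          FieldEnergy.normSq (FieldEnergy.fieldL Λ (fun l => vhat l j) y Ψ) < ∞) ∧
        (∀ j, Integrable fun y =>
          w y * (FieldEnergy.normSq (FieldEnergy.fieldL Λ (fun l => vhat l j) y Ψ)).toReal) ∧
        (Summable fun j => ∫ y,
          w y * (FieldEnergy.normSq (FieldEnergy.fieldL Λ (fun l => vhat l j) y Ψ)).toReal) ∧
        ∑' j, ∫ y,
            w y * (FieldEnergy.normSq (FieldEnergy.fieldL Λ (fun l => vhat l j) y Ψ)).toReal
          ≤ (FieldEnergy.fieldEnergy Ψ).toReal) ∧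
      -- `H_f ≥ ¼ ∑_j ± ∫ w (L_j ± L_j*)² - ½ ∑_j ∑_λ ∫_{|k| < Λ} |k| |vhat_{λ,j}|² ∫ w`
      ((∀ y, 0 ≤ w y) → ∀ (s : J → ℤˣ) (Ψ : FieldEnergy.FockSeq), FieldEnergy.IsFockVector Ψ →
        (1 / 4) * ∑' j, ∫⁻ y, ENNReal.ofReal (w y) *
            FieldEnergy.normSq (FieldEnergy.fieldL Λ (fun l => vhat l j) y Ψ +
              ((s j : ℤ) : ℂ) • FieldEnergy.fieldLstar Λ (fun l => vhat l j) y Ψ)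
          ≤ FieldEnergy.fieldEnergy Ψ +
            (1 / 2) * (∑' j, ∑ l, ∫⁻ k in Metric.ball (0 : FieldEnergy.R3) Λ,
                ENNReal.ofReal ‖k‖ * ‖vhat l j k‖ₑ ^ 2) *
              (∫⁻ y, ENNReal.ofReal (w y)) * FieldEnergy.normSq Ψ)) ∧
    -- `H_f ≥ (1/8π) ∫ B^Λ(x)² w(x) dx - (Λ⁴/8π²) ∫ w`
    (∀ (ε : Fin 2 → FieldEnergy.R3 → FieldEnergy.R3) (w : FieldEnergy.R3 → ℝ),
      FieldEnergy.IsPolarization ε →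
      Integrable w →
      (∀ y, 0 ≤ w y ∧ w y ≤ 1) →
      ∀ Ψ : FieldEnergy.FockSeq, FieldEnergy.IsFockVector Ψ →
        ENNReal.ofReal (1 / (8 * Real.pi)) *
            ∫⁻ x, ENNReal.ofReal (w x) *
              ∑ j, FieldEnergy.normSq (FieldEnergy.magneticField Λ ε j x Ψ)
          ≤ FieldEnergy.fieldEnergy Ψ +
            ENNReal.ofReal (Λ ^ 4 / (8 * Real.pi ^ 2)) *
              (∫⁻ y, ENNReal.ofReal (w y)) * FieldEnergy.normSq Ψ) := by
  refine ⟨fun J v vhat w hv hfin hw h => ⟨fun Ψ hΨ hE => ?_, fun hw0 s Ψ hΨ => ?_⟩,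
    fun ε w hε hw hw01 Ψ hΨ => FieldEnergy.magneticField_bound hΛ hε hw (fun y => (hw01 y).2) hΨ⟩
  · have hA (j : J) (l : Fin 2) := FieldEnergy.memLp_modeCoeff hΛ (hv l j) (hfin l j)
    simp_rw [FieldEnergy.fieldL, FieldEnergy.modeFunction_eq_planeWave]
    exact FieldEnergy.absolutely_convergent_of_tsum_le hw.1
      (fun j => FieldEnergy.aemeasurable_normSq_annihilate (fun l => (hA j l).1) hΨ) hE
      (FieldEnergy.tsum_lintegral_normSq_annihilate_le hw.1.enorm hA (FieldEnergy.modeCoeff_bound hΛ hv hfin hw h) hΨ)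
  · have hA (j : J) (l : Fin 2) := FieldEnergy.memLp_modeCoeff hΛ (hv l j) (hfin l j)
    have hc (j : J) : ‖((s j : ℤ) : ℂ)‖ₑ = 1 := by
      rcases Int.units_eq_one_or (s j) with h | h <;> simp [h]
    have hwe (y : FieldEnergy.R3) : ENNReal.ofReal (w y) = ‖w y‖ₑ := (Real.enorm_of_nonneg (hw0 y)).symm
    simp_rw [FieldEnergy.fieldL, FieldEnergy.fieldLstar, FieldEnergy.modeFunction_eq_planeWave, hwe, ← FieldEnergy.lintegral_modeCoeff_sq]
    refine le_trans ?_ (FieldEnergy.tsum_lintegral_fieldSquareBound_le hw.1.enorm hA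
      (FieldEnergy.modeCoeff_bound hΛ hv hfin hw h) hΨ)
    gcongr with j y
    exact FieldEnergy.mul_normSq_add_le_fieldSquareBound _ (hA j) hΨ (hc j) y
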